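/- **Setting.** All Hilbert spaces are finite-dimensional and $\log$ is to base $2$; $d_{A}=\dim\mathscr H_{A}$; a state is a positive semidefinite operator of unit trace. For positive operators let $F(\rho,\sigma)=\operatorname{Tr}\sqrt{\sqrt\rho\,\sigma\sqrt\rho}$. For $\delta\ge 0$ and a state $\rho^{AB}$ put $$I^{A\to B}_{0,\delta}(\rho^{AB})=\max_{\bar\rho}\ \min_{\sigma^B}\ \bigl(-\log\operatorname{Tr}[\Pi_{\bar\rho}(\mathbf 1_A\otimes\sigma^B)]\bigr),$$ where $\bar\rho$ ranges over the operators on $AB$ with $\bar\rho\ge0$, $\operatorname{Tr}\bar\rho\le1$, $F^2(\rho,\bar\rho)\ge1-\delta^2$, $\sigma^B$ ranges over the states on $B$, $\Pi_{\bar\rho}$ is the projector onto the support of $\bar\rho$, and $-\log 0=+\infty$. An instrument $\mathscr I_A:A\to A'\mathcal X$ is a finite family $\{\mathcal E_x\}_{x\in\mathcal X}$ of completely positive maps from operators on $A$ to operators on $A'$ whose sum is trace preserving; it sends $\rho^{AB}$ to $\sigma^{A'B\mathcal X}=\sum_x(\mathcal E_x\otimes\mathrm{id}_B)(\rho^{AB})\otimes|x\rangle\langle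 x|$. A one-way LOCC map $\Lambda^{\rightarrow}:AB\to A'B'$ is a map $\sum_x\mathcal E_x\otimes\mathcal D_x$ with $\{\mathcal E_x\}$ an instrument on $A$ and every $\mathcal D_x:B\to B'$ completely positive and trace preserving. A two-way LOCC map $\Lambda^{\leftrightarrow}$ is a composition of finitely many one-way LOCC maps, each from $A$ to $B$ or from $B$ to $A$, with arbitrary intermediate systems. For $\varepsilon\ge0$, a real $R\ge0$ is a one-way (two-way) $\varepsilon$-achievable rate for $\rho^{AB}$ if there are an integer $M\ge2^R$, a maximally entangled state $\Psi_M$ of rank $M$ on some $A'B'$ with $\mathscr H_{A'}\simeq\mathscr H_{B'}$ (i.e. $\Psi_M=|\Psi_M\rangle\langle\Psi_M|$ with $|\Psi_M\rangle=M^{-1/2}\sum_{i=1}^M|i^{A'}\rangle\otimes|i^{B'}\rangle$ for some orthonormal bases), and a one-way (two-way) LOCC map $\Lambda:AB\to A'B'$ with $F(\Lambda(\rho^{AB}),\Psi_M)\ge1-\varepsilon$. The one-shot distillable entanglement $E_D^{\rightarrow}(\rho^{AB};\varepsilon)$ (respectively $E_D^{\leftrightarrow}(\rho^{AB};\varepsilon)$)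 is the supremum in $[0,+\infty]$ of the one-way (two-way) $\varepsilon$-achievable rates. **Corollary (Lower bounds).** Let $\rho^{AB}$ be a bipartite state and $\varepsilon\ge0$. Put $$S^{\rightarrow}=\sup_{\Lambda^{\rightarrow}}\Bigl\{I_{0,\varepsilon/8}^{A'\to B'}\bigl(\Lambda^{\rightarrow}(\rho^{AB})\bigr)+\log\Bigl[\tfrac1{d_{A'}}+\tfrac{\varepsilon^2}4\Bigr]\Bigr\},\qquad S^{\mathscr I}=\sup_{\mathscr I_A}\Bigl\{I_{0,\varepsilon/8}^{A'\to B\mathcal X}\bigl(\sigma^{A'B\mathcal X}\bigr)+\log\Bigl[\tfrac1{d_{A'}}+\tfrac{\varepsilon^2}4\Bigr]\Bigr\},$$ the suprema being over all one-way LOCC maps $\Lambda^{\rightarrow}:AB\to A'B'$ with arbitrary output systems, and over all instruments $\mathscr I_A:A\to A'\mathcal X$ with arbitrary $A'$ and finite $\mathcal X$. Define $S^{\leftrightarrow}$ like $S^{\rightarrow}$, with two-way LOCC maps. Then there are $\Delta,\Delta',\Delta''\in[0,1]$ with $$E_D^{\rightarrow}(\rho^{AB};\varepsilon)\ \ge\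 S^{\rightarrow}-\Delta\ \ge\ S^{\mathscr I}-\Delta',\qquad E_D^{\leftrightarrow}(\rho^{AB};\varepsilon)\ \ge\ S^{\leftrightarrow}-\Delta''.$$ If $\varepsilon<1$, then moreover each of $S^{\rightarrow}-\Delta$, $S^{\mathscr I}-\Delta'$, $S^{\leftrightarrow}-\Delta''$ is the logarithm of a positive integer; more precisely, each $S-\Delta$ equals $\log n$ for an integer $n\ge1$ with $\log n\le S<\log(n+1)$ (so all three suprema are finite). -/

import Mathlib

open scoped Kronecker MatrixOrder ComplexOrder

noncomputable section

namespace QDistill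

/-- Operators on the finite-dimensional Hilbert space `ℂ^ι`, in the standard basis. -/
abbrev Op (ι : Type) : Type := Matrix ι ι ℂ

/-- A state (density operator): positive semidefinite with unit trace. -/
def IsState {ι : Type} [Fintype ι] (ρ : Op ι) : Prop :=
  ρ.PosSemidef ∧ ρ.trace = 1

/-- The fidelity `F(ρ, σ) = Tr √(√ρ σ √ρ)` (the square root of the squared-overlap convention). -/
def fidelity {ι : Type} [Fintype ι] [DecidableEq ι] (ρ σ : Op ι) : ℝ :=
  (CFC.sqrt (CFC.sqrt ρ * σ * CFC.sqrt ρ)).trace.re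

/-- The smoothing ball of subnormalized operators
`{σ : σ ≥ 0, Tr σ ≤ 1, F(ρ, σ)² ≥ 1 - δ²}`. -/
def smoothBall {ι : Type} [Fintype ι] [DecidableEq ι] (ρ : Op ι) (δ : ℝ) : Set (Op ι) :=
  {σ | σ.PosSemidef ∧ σ.trace.re ≤ 1 ∧ 1 - δ ^ 2 ≤ fidelity ρ σ ^ 2}

/-- The orthogonal projector onto the support of a Hermitian operator: the spectral projector
onto the nonzero eigenvalues. -/
def supportProj {ι : Type} [Fintype ι] [DecidableEq ι] (ρ : Op ι) : Op ι :=
  cfc (fun x : ℝ => if x = 0 then (0 : ℝ) else 1) ρ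

/-- `-log₂ x` for `x ≥ 0`, with `-log₂ 0 = +∞`. -/
def negLog (x : ℝ) : EReal :=
  if x ≤ 0 then ⊤ else ((-Real.logb 2 x : ℝ) : EReal)

/-- The relative Rényi entropy of order zero, `S₀(ρ‖σ) = -log₂ Tr[Π_ρ σ]`. -/
def relEntropyZero {ι : Type} [Fintype ι] [DecidableEq ι] (ρ σ : Op ι) : EReal :=
  negLog (supportProj ρ * σ).trace.re

/-- The smoothed zero-coherent information
`I_{0,δ}^{A→B}(ρ) = max_{ρ̄ ∈ ball(ρ; δ)} min_{σ state on B} S₀(ρ̄ ‖ 1_A ⊗ σ)`. -/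
def zeroCohInfo {A B : Type} [Fintype A] [DecidableEq A] [Fintype B] [DecidableEq B]
    (δ : ℝ) (ρ : Op (A × B)) : EReal :=
  ⨆ ρ' ∈ smoothBall ρ δ, ⨅ σ ∈ {σ : Op B | IsState σ},
    relEntropyZero ρ' ((1 : Op A) ⊗ₖ σ)

/-- The tensor product `E ⊗ D` of linear maps on operators, acting on operators on `A ⊗ B`:
on product matrix units it is `E(|a⟩⟨c|) ⊗ D(|b⟩⟨d|)`, extended linearly. -/
def tensorMap {A B A' B' : Type} [Fintype A] [DecidableEq A] [Fintype B] [DecidableEq B]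
    (E : Op A →ₗ[ℂ] Op A') (D : Op B →ₗ[ℂ] Op B') : Op (A × B) →ₗ[ℂ] Op (A' × B') where
  toFun X := ∑ a, ∑ b, ∑ c, ∑ d,
    X (a, b) (c, d) • (E (Matrix.single a c 1) ⊗ₖ D (Matrix.single b d 1))
  map_add' X Y := by
    simp only [Matrix.add_apply, add_smul, Finset.sum_add_distrib]
  map_smul' r X := by
    simp only [Matrix.smul_apply, smul_eq_mul, mul_smul, Finset.smul_sum, RingHom.id_apply]

/-- Complete positivity: `id_k ⊗ E` preserves positive semidefiniteness for every `k`. -/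
def IsCP {A A' : Type} [Fintype A] [DecidableEq A] (E : Op A →ₗ[ℂ] Op A') : Prop :=
  ∀ (k : ℕ) (X : Op (Fin k × A)), X.PosSemidef →
    (tensorMap (LinearMap.id : Op (Fin k) →ₗ[ℂ] Op (Fin k)) E X).PosSemidef

/-- Trace preservation. -/
def IsTP {A A' : Type} [Fintype A] [Fintype A'] (E : Op A →ₗ[ℂ] Op A') : Prop :=
  ∀ X : Op A, (E X).trace = X.trace

/-- A completely positive instrument with outcomes `Fin k`: completely positive maps whose sum
is trace preserving. -/
def IsInstrument {A A' : Type} [Fintype A] [DecidableEq A] [Fintype A'] {k : ℕ}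
    (E : Fin k → (Op A →ₗ[ℂ] Op A')) : Prop :=
  (∀ x, IsCP (E x)) ∧ IsTP (∑ x, E x)

/-- Transformations of bipartite operators from local dimensions `(a, b)` to `(a', b')`. -/
abbrev BipartiteMap (a b a' b' : ℕ) : Type :=
  Op (Fin a × Fin b) →ₗ[ℂ] Op (Fin a' × Fin b')

/-- One-way LOCC from Alice to Bob: Alice applies an instrument and sends its outcome `x` to Bob,
who applies a channel depending on `x`. -/
def IsOneWayLOCC {a b a' b' : ℕ} (L : BipartiteMap a b a' b') : Prop :=
  ∃ (k : ℕ) (E : Fin k → (Op (Fin a) →ₗ[ℂ] Op (Fin a')))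
    (D : Fin k → (Op (Fin b) →ₗ[ℂ] Op (Fin b'))),
    IsInstrument E ∧ (∀ x, IsCP (D x) ∧ IsTP (D x)) ∧ L = ∑ x, tensorMap (E x) (D x)

/-- One-way LOCC from Bob to Alice. -/
def IsBackwardLOCC {a b a' b' : ℕ} (L : BipartiteMap a b a' b') : Prop :=
  ∃ (k : ℕ) (D : Fin k → (Op (Fin a) →ₗ[ℂ] Op (Fin a')))
    (E : Fin k → (Op (Fin b) →ₗ[ℂ] Op (Fin b'))),
    IsInstrument E ∧ (∀ x, IsCP (D x) ∧ IsTP (D x)) ∧ L = ∑ x, tensorMap (D x) (E x)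

/-- Two-way LOCC: finitely many rounds of one-way LOCC in either direction. The intermediate
systems are arbitrary, so the parties may keep records of all earlier classical messages. -/
inductive IsTwoWayLOCC : ∀ {a b a' b' : ℕ}, BipartiteMap a b a' b' → Prop
  | forward {a b a' b' : ℕ} {L : BipartiteMap a b a' b'} :
      IsOneWayLOCC L → IsTwoWayLOCC L
  | backward {a b a' b' : ℕ} {L : BipartiteMap a b a' b'} :
      IsBackwardLOCC L → IsTwoWayLOCC L
  | comp {a b a' b' a'' b'' : ℕ} {L₁ : BipartiteMap a b a' b'}
      {L₂ : BipartiteMap a' b' a'' b''} :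
      IsTwoWayLOCC L₁ → IsTwoWayLOCC L₂ → IsTwoWayLOCC (L₂ ∘ₗ L₁)

/-- A maximally entangled state vector of rank `M ≤ d` on `ℂ^d ⊗ ℂ^d`:
`M^{-1/2} ∑_{i < M} e_i ⊗ f_i` for orthonormal bases `e`, `f`. -/
def IsMaxEntangled (M d : ℕ) (ψ : Fin d × Fin d → ℂ) : Prop :=
  1 ≤ M ∧ ∃ (hM : M ≤ d) (e f : OrthonormalBasis (Fin d) ℂ (EuclideanSpace ℂ (Fin d))),
    ∀ p, ψ p = ((1 / Real.sqrt M : ℝ) : ℂ) *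
      ∑ i : Fin M, e (Fin.castLE hM i) p.1 * f (Fin.castLE hM i) p.2

/-- The rank-one operator `|ψ⟩⟨ψ|`. -/
def pureOp {ι : Type} (ψ : ι → ℂ) : Op ι :=
  Matrix.vecMulVec ψ (star ψ)

/-- A class of allowed transformations starting from local dimensions `(a, b)`. -/
abbrev MapClass (a b : ℕ) : Type :=
  ∀ a' b' : ℕ, BipartiteMap a b a' b' → Prop

/-- `R ≥ 0` is an `ε`-achievable distillation rate for `ρ` with the maps of the class `C`: some
maximally entangled state of rank `M ≥ 2^R` is reached with fidelity at least `1 - ε`. -/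
def IsAchievable {a b : ℕ} (C : MapClass a b) (ρ : Op (Fin a × Fin b)) (ε R : ℝ) : Prop :=
  0 ≤ R ∧ ∃ (M d : ℕ) (L : BipartiteMap a b d d) (ψ : Fin d × Fin d → ℂ),
    (2 : ℝ) ^ R ≤ M ∧ C d d L ∧ IsMaxEntangled M d ψ ∧ 1 - ε ≤ fidelity (L ρ) (pureOp ψ)

/-- The largest `ε`-achievable rate. -/
def distillable {a b : ℕ} (C : MapClass a b) (ρ : Op (Fin a × Fin b)) (ε : ℝ) : EReal :=
  ⨆ R ∈ {R : ℝ | IsAchievable C ρ ε R}, (R : EReal)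

/-- One-way LOCC maps from local dimensions `(a, b)`. -/
def oneWay (a b : ℕ) : MapClass a b := fun _ _ L => IsOneWayLOCC L

/-- Two-way LOCC maps from local dimensions `(a, b)`. -/
def twoWay (a b : ℕ) : MapClass a b := fun _ _ L => IsTwoWayLOCC L

/-- The hashing quantity `I_{0,ε/8}^{A→B}(σ) + log₂(1/d_A + ε²/4)`. -/
def hashing {A B : Type} [Fintype A] [DecidableEq A] [Fintype B] [DecidableEq B]
    (ε : ℝ) (σ : Op (A × B)) : EReal :=
  zeroCohInfo (ε / 8) σ + ((Real.logb 2 (1 / (Fintype.card A : ℝ) + ε ^ 2 / 4) : ℝ) : EReal)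

/-- The best hashing quantity of `L(ρ)` over all preprocessing maps `L : AB → A'B'` of the
class `C`, with arbitrary output systems. -/
def bestHashing {a b : ℕ} (C : MapClass a b) (ρ : Op (Fin a × Fin b)) (ε : ℝ) : EReal :=
  ⨆ (a' : ℕ) (b' : ℕ) (L : BipartiteMap a b a' b') (_ : C a' b' L), hashing ε (L ρ)

/-- The output `∑ₓ (E_x ⊗ id_B)(ρ) ⊗ |x⟩⟨x|` of an instrument on `A`, on `A' ⊗ (B ⊗ X)`. -/
def instrumentOutput {A B A' : Type} [Fintype A] [DecidableEq A] [Fintype B] [DecidableEq B]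
    {k : ℕ} (E : Fin k → (Op A →ₗ[ℂ] Op A')) (ρ : Op (A × B)) : Op (A' × (B × Fin k)) :=
  Matrix.of fun p q =>
    if p.2.2 = q.2.2 then
      tensorMap (E p.2.2) (LinearMap.id : Op B →ₗ[ℂ] Op B) ρ (p.1, p.2.1) (q.1, q.2.1)
    else 0

/-- The best hashing quantity, with respect to `A' → BX`, of the output of an instrument
`A → A'X`, over all instruments on `A`, with arbitrary `A'` and arbitrary finite outcome set. -/
def bestInstrumentHashing {a b : ℕ} (ρ : Op (Fin a × Fin b)) (ε : ℝ) : EReal :=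
  ⨆ (a' : ℕ) (k : ℕ) (E : Fin k → (Op (Fin a) →ₗ[ℂ] Op (Fin a'))) (_ : IsInstrument E),
    hashing ε (instrumentOutput E ρ)

/-- `Δ` is the least nonnegative number for which `S - Δ` is the logarithm of a positive
integer, namely of `n = ⌊2^S⌋ ≥ 1`. -/
def RoundsToLogNat (S : EReal) (Δ : ℝ) : Prop :=
  ∃ n : ℕ, 1 ≤ n ∧ S - (Δ : EReal) = ((Real.logb 2 n : ℝ) : EReal) ∧
    S < ((Real.logb 2 (n + 1) : ℝ) : EReal)

end QDistill

end

set_option linter.unusedSectionVars false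

noncomputable section

namespace QDistill

/-! ### Tensor products of linear maps on operators -/

section TensorMap

variable {A B A' B' A'' B'' : Type} [Fintype A] [DecidableEq A] [Fintype B] [DecidableEq B]
  [Fintype A'] [DecidableEq A'] [Fintype B'] [DecidableEq B']
  [Fintype A''] [DecidableEq A''] [Fintype B''] [DecidableEq B'']

/-! The heart is the claim `isAchievable_of_le_bestHashing`: for ε < 1, if M ≥ 1 and log M ≤ S, then
log M is an achievable rate. Given this, n = ⌊2^S⌋ and Δ = S - log n work, with Δ ≤ 1 because n + 1
≤ 2n. The instrument quantity is at most the one-way quantity because Bob can store the outcome in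
his own system, and taking floors preserves the order. Nonnegativity of S comes from an instrument
with one-dimensional output. Finiteness combines the claim with a bound on the rank
(`exists_rank_bound`): conjugation by the partial transpose keeps LOCC maps positive, while M times
the partial transpose of a rank-M maximally entangled state has spectrum in {-1, 0, 1}. For ε ≥ 1
the fidelity condition is void and all rates are achievable.

For the claim with M ≥ 2, let P be the support projector of a nearly optimal smoothed operator. Then
Tr[Pρ] ≥ 1 - (ε/8)² by `fidelity_sq_le`, and Tr_A P ≤ κ·1 with Mκ slightly above 1/d + ε²/4, where d
is the dimension of A. Alice's outcome is a random hash A → Fin M with random cube-root phases, and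
her Kraus operator sends each basis vector to its bucket with its phase. Let N_x be the slices of P,
so that P = ∑ N_xᴴ N_x, let Y_i be their hashed combinations and W = M ∑ Y_i Y_iᴴ. Bob decodes with
2 Y_iᴴ (1 + W)⁻¹, where 2/(1 + w) replaces the w^(-1/2) of a polar decoder. Both facts needed follow
from (1 - w)² ≥ 0: 4w ≤ (1 + w)² makes the decoder a contraction, and 2/(1 + w) ≥ (3 - w)/2 bounds
the overlap below by second and fourth moments of the hash, which are computed exactly. On average
the overlap operator is at least (1 - Mκ/2) P (`le_trace_decoder`); convexity of the square and a
pinching inequality then give the fidelity (`exists_protocol`). Finally `one_le_card_mul` shows 1/d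
≤ κ, so for M ≥ 2 the term 1/d is absorbed and Mκ is of order ε². -/

theorem ext_kronecker {V : Type*} [AddCommMonoid V] [Module ℂ V]
    {f g : Op (A × B) →ₗ[ℂ] V} (h : ∀ X Y, f (X ⊗ₖ Y) = g (X ⊗ₖ Y)) : f = g := by
  refine Matrix.ext_linearMap ℂ fun p q => LinearMap.ext_ring ?_
  have := h (Matrix.single p.1 q.1 1) (Matrix.single p.2 q.2 1)
  rwa [Matrix.single_kronecker_single, one_mul] at this

theorem tensorMap_kronecker (E : Op A →ₗ[ℂ] Op A') (D : Op B →ₗ[ℂ] Op B') (X : Op A) (Y : Op B) :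
    tensorMap E D (X ⊗ₖ Y) = E X ⊗ₖ D Y := by
  conv_rhs => rw [Matrix.matrix_eq_sum_single X, Matrix.matrix_eq_sum_single Y]
  ext p q
  simp only [tensorMap, LinearMap.coe_mk, AddHom.coe_mk, Matrix.sum_apply, Matrix.smul_apply,
    Matrix.kroneckerMap_apply, map_sum, smul_eq_mul, Finset.sum_mul_sum]
  refine Finset.sum_congr rfl fun a _ => Finset.sum_congr rfl fun b _ => ?_
  refine Finset.sum_congr rfl fun c _ => Finset.sum_congr rfl fun d _ => ?_
  rw [← mul_one (X a c), ← mul_one (Y b d), ← smul_eq_mul (X a c), ← smul_eq_mul (Y b d),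
    ← Matrix.smul_single, ← Matrix.smul_single, map_smul, map_smul]
  simp only [Matrix.smul_apply, smul_eq_mul, mul_one]
  ring

theorem tensorMap_comp (E : Op A →ₗ[ℂ] Op A') (D : Op B →ₗ[ℂ] Op B')
    (E' : Op A' →ₗ[ℂ] Op A'') (D' : Op B' →ₗ[ℂ] Op B'') :
    tensorMap E' D' ∘ₗ tensorMap E D = tensorMap (E' ∘ₗ E) (D' ∘ₗ D) :=
  ext_kronecker fun X Y => by simp [tensorMap_kronecker]

theorem tensorMap_sum_left {ι : Type*} (s : Finset ι) (E : ι → (Op A →ₗ[ℂ] Op A'))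
    (D : Op B →ₗ[ℂ] Op B') : tensorMap (∑ x ∈ s, E x) D = ∑ x ∈ s, tensorMap (E x) D :=
  ext_kronecker fun X Y => by
    ext p q
    simp [tensorMap_kronecker, LinearMap.sum_apply, Matrix.sum_apply, Finset.sum_mul]

theorem tensorMap_sum_right {ι : Type*} (s : Finset ι) (E : Op A →ₗ[ℂ] Op A')
    (D : ι → (Op B →ₗ[ℂ] Op B')) : tensorMap E (∑ x ∈ s, D x) = ∑ x ∈ s, tensorMap E (D x) :=
  ext_kronecker fun X Y => by
    ext p q
    simp [tensorMap_kronecker, LinearMap.sum_apply, Matrix.sum_apply, Finset.mul_sum]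

theorem tensorMap_id_id :
    tensorMap (LinearMap.id : Op A →ₗ[ℂ] Op A) (LinearMap.id : Op B →ₗ[ℂ] Op B) = LinearMap.id :=
  ext_kronecker fun X Y => by simp [tensorMap_kronecker]

theorem tensorMap_eq_comp (E : Op A →ₗ[ℂ] Op A') (D : Op B →ₗ[ℂ] Op B') :
    tensorMap E D = tensorMap E LinearMap.id ∘ₗ tensorMap LinearMap.id D := by
  rw [tensorMap_comp]; rfl

/-- The map `X ↦ V X Vᴴ` with a single Kraus operator. -/
def kraus (V : Matrix A' A ℂ) : Op A →ₗ[ℂ] Op A' where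
  toFun X := V * X * V.conjTranspose
  map_add' X Y := by rw [Matrix.mul_add, Matrix.add_mul]
  map_smul' r X := by simp

@[simp] theorem kraus_apply (V : Matrix A' A ℂ) (X : Op A) :
    kraus V X = V * X * V.conjTranspose := rfl

theorem tensorMap_kraus (V : Matrix A' A ℂ) (W : Matrix B' B ℂ) :
    tensorMap (kraus V) (kraus W) = kraus (V ⊗ₖ W) :=
  ext_kronecker fun X Y => by
    simp [tensorMap_kronecker, Matrix.mul_kronecker_mul, Matrix.conjTranspose_kronecker]

theorem kraus_one : kraus (1 : Op A) = LinearMap.id := by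
  ext; simp

theorem trace_tensorMap_of_isTP (E : Op A →ₗ[ℂ] Op A') {D : Op B →ₗ[ℂ] Op B'} (hD : IsTP D) :
    Matrix.traceLinearMap _ ℂ ℂ ∘ₗ tensorMap E D =
      Matrix.traceLinearMap _ ℂ ℂ ∘ₗ tensorMap E (LinearMap.id : Op B →ₗ[ℂ] Op B) :=
  ext_kronecker fun X Y => by
    simp [tensorMap_kronecker, Matrix.trace_kronecker, hD Y]

theorem trace_tensorMap_of_isTP' {E : Op A →ₗ[ℂ] Op A'} (hE : IsTP E) (D : Op B →ₗ[ℂ] Op B') :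
    Matrix.traceLinearMap _ ℂ ℂ ∘ₗ tensorMap E D =
      Matrix.traceLinearMap _ ℂ ℂ ∘ₗ tensorMap (LinearMap.id : Op A →ₗ[ℂ] Op A) D :=
  ext_kronecker fun X Y => by
    simp [tensorMap_kronecker, Matrix.trace_kronecker, hE X]

theorem comp_finset_sum {U V W ι : Type*} [AddCommMonoid U] [AddCommMonoid V] [AddCommMonoid W]
    [Module ℂ U] [Module ℂ V] [Module ℂ W] (f : V →ₗ[ℂ] W) (s : Finset ι) (g : ι → (U →ₗ[ℂ] V)) :
    f ∘ₗ (∑ x ∈ s, g x) = ∑ x ∈ s, f ∘ₗ g x := by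
  ext; simp

/-- Under the trace each D x may be replaced by the identity, after which only the trace-preserving
sum of the E x is left. -/
theorem isTP_sum_tensorMap {ι : Type*} (s : Finset ι) {E : ι → (Op A →ₗ[ℂ] Op A')}
    {D : ι → (Op B →ₗ[ℂ] Op B')} (hE : IsTP (∑ x ∈ s, E x)) (hD : ∀ x, IsTP (D x)) :
    IsTP (∑ x ∈ s, tensorMap (E x) (D x)) := by
  suffices h : Matrix.traceLinearMap _ ℂ ℂ ∘ₗ (∑ x ∈ s, tensorMap (E x) (D x)) =
      Matrix.traceLinearMap _ ℂ ℂ from fun X => LinearMap.congr_fun h X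
  rw [comp_finset_sum, Finset.sum_congr rfl fun x _ => trace_tensorMap_of_isTP (E x) (hD x),
    ← comp_finset_sum, ← tensorMap_sum_left, trace_tensorMap_of_isTP' hE, tensorMap_id_id]
  rfl

theorem isTP_sum_tensorMap' {ι : Type*} (s : Finset ι) {E : ι → (Op B →ₗ[ℂ] Op B')}
    {D : ι → (Op A →ₗ[ℂ] Op A')} (hE : IsTP (∑ x ∈ s, E x)) (hD : ∀ x, IsTP (D x)) :
    IsTP (∑ x ∈ s, tensorMap (D x) (E x)) := by
  suffices h : Matrix.traceLinearMap _ ℂ ℂ ∘ₗ (∑ x ∈ s, tensorMap (D x) (E x)) =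
      Matrix.traceLinearMap _ ℂ ℂ from fun X => LinearMap.congr_fun h X
  rw [comp_finset_sum, Finset.sum_congr rfl fun x _ => trace_tensorMap_of_isTP' (hD x) (E x),
    ← comp_finset_sum, ← tensorMap_sum_right, trace_tensorMap_of_isTP _ hE, tensorMap_id_id]
  rfl

end TensorMap

/-! ### Positivity and complete positivity -/

section CompletelyPositive

variable {A B A' B' A'' : Type} [Fintype A] [DecidableEq A] [Fintype B] [DecidableEq B]
  [Fintype A'] [DecidableEq A'] [Fintype B'] [DecidableEq B'] [Fintype A''] [DecidableEq A'']

/-- Positivity of a map on operators. -/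
def IsPositiveMap (E : Op A →ₗ[ℂ] Op A') : Prop := ∀ X : Op A, X.PosSemidef → (E X).PosSemidef

theorem isPositiveMap_sum {ι : Type*} (s : Finset ι) {E : ι → (Op A →ₗ[ℂ] Op A')}
    (h : ∀ x, IsPositiveMap (E x)) : IsPositiveMap (∑ x ∈ s, E x) := fun X hX => by
  rw [LinearMap.sum_apply]
  exact Matrix.posSemidef_sum s fun x _ => h x X hX

theorem isPositiveMap_kraus (V : Matrix A' A ℂ) : IsPositiveMap (kraus V) := fun X hX => by
  rw [kraus_apply]
  exact hX.mul_mul_conjTranspose_same V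

theorem isCP_sum {ι : Type*} (s : Finset ι) {E : ι → (Op A →ₗ[ℂ] Op A')}
    (h : ∀ x, IsCP (E x)) : IsCP (∑ x ∈ s, E x) := fun k => by
  rw [tensorMap_sum_right]
  exact isPositiveMap_sum s fun x => h x k

theorem isCP_kraus (V : Matrix A' A ℂ) : IsCP (kraus V) := fun k => by
  rw [← kraus_one, tensorMap_kraus]
  exact isPositiveMap_kraus _

theorem IsCP.comp {E : Op A →ₗ[ℂ] Op A'} {E' : Op A' →ₗ[ℂ] Op A''} (hE' : IsCP E')
    (hE : IsCP E) : IsCP (E' ∘ₗ E) := fun k X hX => by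
  have := hE' k _ (hE k X hX)
  rwa [← LinearMap.comp_apply, tensorMap_comp] at this

theorem IsTP.comp {E : Op A →ₗ[ℂ] Op A'} {E' : Op A' →ₗ[ℂ] Op A''} (hE' : IsTP E')
    (hE : IsTP E) : IsTP (E' ∘ₗ E) := fun X => by
  rw [LinearMap.comp_apply, hE', hE]

/-- `IsCP` only speaks of ancillas `Fin k`; commuting with relabellings of the ancilla extends it to
every finite type. -/
theorem tensorMap_id_left_submatrix (e : B ≃ A) (E : Op A' →ₗ[ℂ] Op B') (X : Op (A × A')) :
    (tensorMap LinearMap.id E X).submatrix (Prod.map e id) (Prod.map e id) =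
      tensorMap LinearMap.id E (X.submatrix (Prod.map e id) (Prod.map e id)) := by
  let S (F : Type) : Op (A × F) →ₗ[ℂ] Op (B × F) :=
    { toFun := fun Y => Y.submatrix (Prod.map e id) (Prod.map e id)
      map_add' := fun _ _ => rfl
      map_smul' := fun _ _ => rfl }
  have hS (F : Type) (Y : Op A) (Z : Op F) : S F (Y ⊗ₖ Z) = (Y.submatrix e e) ⊗ₖ Z := by
    rfl
  have : S B' ∘ₗ tensorMap LinearMap.id E = tensorMap LinearMap.id E ∘ₗ S A' :=
    ext_kronecker fun Y Z => by simp [tensorMap_kronecker, hS]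
  exact LinearMap.congr_fun this X

theorem IsCP.tensorMap_id_left {E : Op A →ₗ[ℂ] Op A'} (hE : IsCP E) :
    IsPositiveMap (tensorMap (LinearMap.id : Op B →ₗ[ℂ] Op B) E) := fun X hX => by
  let e := Fintype.equivFin B
  have h := hE (Fintype.card B) _ (hX.submatrix (Prod.map e.symm id))
  rw [← tensorMap_id_left_submatrix] at h
  have h' := h.submatrix (Prod.map e id)
  rw [Matrix.submatrix_submatrix] at h'
  simpa [Prod.map_comp_map] using h'

theorem IsCP.tensorMap_id_right {E : Op A →ₗ[ℂ] Op A'} (hE : IsCP E) :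
    IsPositiveMap (tensorMap E (LinearMap.id : Op B →ₗ[ℂ] Op B)) := fun X hX => by
  let S (F G : Type) : Op (F × G) →ₗ[ℂ] Op (G × F) :=
    { toFun := fun Y => Y.submatrix Prod.swap Prod.swap
      map_add' := fun _ _ => rfl
      map_smul' := fun _ _ => rfl }
  have hS (F G : Type) (Y : Op F) (Z : Op G) : S F G (Y ⊗ₖ Z) = Z ⊗ₖ Y := by
    ext p q; exact mul_comm _ _
  have h : tensorMap E (LinearMap.id : Op B →ₗ[ℂ] Op B) =
      S B A' ∘ₗ tensorMap LinearMap.id E ∘ₗ S A B :=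
    ext_kronecker fun Y Z => by simp [tensorMap_kronecker, hS]
  rw [h]
  exact (hE.tensorMap_id_left _ (hX.submatrix Prod.swap)).submatrix Prod.swap

theorem IsCP.tensorMap {E : Op A →ₗ[ℂ] Op A'} {D : Op B →ₗ[ℂ] Op B'} (hE : IsCP E)
    (hD : IsCP D) : IsPositiveMap (tensorMap E D) := fun X hX => by
  rw [tensorMap_eq_comp]
  exact hE.tensorMap_id_right _ (hD.tensorMap_id_left X hX)

/-- The map `X ↦ (E Xᵀ)ᵀ`. -/
def transposeConj (E : Op A →ₗ[ℂ] Op A') : Op A →ₗ[ℂ] Op A' where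
  toFun X := (E X.transpose).transpose
  map_add' X Y := by simp
  map_smul' r X := by simp

theorem transposeConj_apply (E : Op A →ₗ[ℂ] Op A') (X : Op A) :
    transposeConj E X = (E X.transpose).transpose := rfl

theorem transpose_kronecker {F G : Type} (X : Op F) (Y : Op G) :
    (X ⊗ₖ Y).transpose = X.transpose ⊗ₖ Y.transpose :=
  (Matrix.kroneckerMap_transpose _ X Y).symm

/-- Tensoring the conjugated map with the identity is conjugating `id ⊗ E` by the full transpose,
which preserves positivity. -/
theorem IsCP.transposeConj {E : Op A →ₗ[ℂ] Op A'} (hE : IsCP E) : IsCP (transposeConj E) :=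
  fun k => by
    have h : QDistill.tensorMap (LinearMap.id : Op (Fin k) →ₗ[ℂ] _) (QDistill.transposeConj E) =
        QDistill.transposeConj (QDistill.tensorMap LinearMap.id E) :=
      ext_kronecker fun Y Z => by
        simp [tensorMap_kronecker, transposeConj_apply, transpose_kronecker]
    rw [h]
    exact fun X hX => (hE k _ hX.transpose).transpose

end CompletelyPositive

/-! ### Local operations and classical communication -/

section LOCC

variable {a b a' b' a'' b'' : ℕ}

theorem isOneWayLOCC_sum {G : Type*} [Fintype G] {E : G → (Op (Fin a) →ₗ[ℂ] Op (Fin a'))}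
    {D : G → (Op (Fin b) →ₗ[ℂ] Op (Fin b'))} (hE : ∀ g, IsCP (E g)) (hT : IsTP (∑ g, E g))
    (hD : ∀ g, IsCP (D g) ∧ IsTP (D g)) : IsOneWayLOCC (∑ g, tensorMap (E g) (D g)) := by
  let e := (Fintype.equivFin G).symm
  refine ⟨Fintype.card G, E ∘ e, D ∘ e, ⟨fun x => hE _, ?_⟩, fun x => hD _, ?_⟩
  · rwa [← Equiv.sum_comp e] at hT
  · rw [← Equiv.sum_comp e]; rfl

theorem IsOneWayLOCC.comp {L' : BipartiteMap a' b' a'' b''} {L : BipartiteMap a b a' b'}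
    (hL' : IsOneWayLOCC L') (hL : IsOneWayLOCC L) : IsOneWayLOCC (L' ∘ₗ L) := by
  obtain ⟨k', E', D', ⟨hE', hT'⟩, hD', rfl⟩ := hL'
  obtain ⟨k, E, D, ⟨hE, hT⟩, hD, rfl⟩ := hL
  have h : (∑ x, tensorMap (E' x) (D' x)) ∘ₗ (∑ x, tensorMap (E x) (D x)) =
      ∑ p : Fin k' × Fin k, tensorMap (E' p.1 ∘ₗ E p.2) (D' p.1 ∘ₗ D p.2) := by
    rw [Fintype.sum_prod_type, comp_finset_sum, Finset.sum_comm]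
    refine Finset.sum_congr rfl fun x _ => ?_
    simp_rw [← tensorMap_comp]
    ext1 X
    simp [LinearMap.sum_apply]
  rw [h]
  refine isOneWayLOCC_sum (fun p => (hE' _).comp (hE _)) ?_
    fun p => ⟨(hD' _).1.comp (hD _).1, (hD' _).2.comp (hD _).2⟩
  have h' : ∑ p : Fin k' × Fin k, E' p.1 ∘ₗ E p.2 = (∑ x, E' x) ∘ₗ ∑ x, E x := by
    rw [Fintype.sum_prod_type, comp_finset_sum, Finset.sum_comm]
    refine Finset.sum_congr rfl fun x _ => ?_
    ext1 X
    simp [LinearMap.sum_apply]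
  rw [h']
  exact hT'.comp hT

theorem IsOneWayLOCC.isPositiveMap_isTP {L : BipartiteMap a b a' b'} (hL : IsOneWayLOCC L) :
    IsPositiveMap L ∧ IsTP L := by
  obtain ⟨k, E, D, ⟨hE, hT⟩, hD, rfl⟩ := hL
  exact ⟨isPositiveMap_sum _ fun x => (hE x).tensorMap (hD x).1,
    isTP_sum_tensorMap _ hT fun x => (hD x).2⟩

theorem IsBackwardLOCC.isPositiveMap_isTP {L : BipartiteMap a b a' b'} (hL : IsBackwardLOCC L) :
    IsPositiveMap L ∧ IsTP L := by
  obtain ⟨k, D, E, ⟨hE, hT⟩, hD, rfl⟩ := hL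
  exact ⟨isPositiveMap_sum _ fun x => (hD x).1.tensorMap (hE x),
    isTP_sum_tensorMap' _ hT fun x => (hD x).2⟩

theorem IsTwoWayLOCC.isPositiveMap_isTP {L : BipartiteMap a b a' b'} (hL : IsTwoWayLOCC L) :
    IsPositiveMap L ∧ IsTP L := by
  induction hL with
  | forward h => exact h.isPositiveMap_isTP
  | backward h => exact h.isPositiveMap_isTP
  | comp _ _ h₁ h₂ => exact ⟨fun X hX => h₂.1 _ (h₁.1 X hX), h₂.2.comp h₁.2⟩

theorem IsState.map {ι κ : Type} [Fintype ι] [Fintype κ] {L : Op ι →ₗ[ℂ] Op κ} {ρ : Op ι}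
    (hρ : IsState ρ) (hL : IsPositiveMap L ∧ IsTP L) : IsState (L ρ) :=
  ⟨hL.1 ρ hρ.1, (hL.2 ρ).trans hρ.2⟩

/-- The partial transpose on the second tensor factor. -/
def partialTranspose {A B : Type} : Op (A × B) →ₗ[ℂ] Op (A × B) where
  toFun X := Matrix.of fun p q => X (p.1, q.2) (q.1, p.2)
  map_add' _ _ := rfl
  map_smul' _ _ := rfl

@[simp] theorem partialTranspose_apply {A B : Type} (X : Op (A × B)) (p q : A × B) :
    partialTranspose X p q = X (p.1, q.2) (q.1, p.2) := rfl

theorem partialTranspose_kronecker {A B : Type} (X : Op A) (Y : Op B) :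
    partialTranspose (X ⊗ₖ Y) = X ⊗ₖ Y.transpose := rfl

theorem partialTranspose_tensorMap {A B A' B' : Type} [Fintype A] [DecidableEq A] [Fintype B]
    [DecidableEq B] [Fintype A'] [DecidableEq A'] [Fintype B'] [DecidableEq B']
    (E : Op A →ₗ[ℂ] Op A') (D : Op B →ₗ[ℂ] Op B') :
    partialTranspose ∘ₗ tensorMap E D ∘ₗ partialTranspose = tensorMap E (transposeConj D) :=
  ext_kronecker fun X Y => by
    simp [tensorMap_kronecker, partialTranspose_kronecker, transposeConj_apply]

theorem partialTranspose_sum {A B A' B' ι : Type} (s : Finset ι)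
    (L : ι → (Op (A × B) →ₗ[ℂ] Op (A' × B'))) :
    partialTranspose ∘ₗ (∑ x ∈ s, L x) ∘ₗ partialTranspose =
      ∑ x ∈ s, partialTranspose ∘ₗ L x ∘ₗ partialTranspose := by
  ext1 X; simp [LinearMap.sum_apply]

/-- Conjugation by the partial transpose leaves Alice's maps alone and turns Bob's into
`transposeConj`, again completely positive. This is the feature of LOCC behind the rank bound. -/
theorem IsOneWayLOCC.partialTranspose {L : BipartiteMap a b a' b'} (hL : IsOneWayLOCC L) :
    IsPositiveMap (partialTranspose ∘ₗ L ∘ₗ partialTranspose) := by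
  obtain ⟨k, E, D, ⟨hE, hT⟩, hD, rfl⟩ := hL
  rw [partialTranspose_sum]
  simp_rw [partialTranspose_tensorMap]
  exact isPositiveMap_sum _ fun x => (hE x).tensorMap (hD x).1.transposeConj

theorem IsBackwardLOCC.partialTranspose {L : BipartiteMap a b a' b'} (hL : IsBackwardLOCC L) :
    IsPositiveMap (partialTranspose ∘ₗ L ∘ₗ partialTranspose) := by
  obtain ⟨k, D, E, ⟨hE, hT⟩, hD, rfl⟩ := hL
  rw [partialTranspose_sum]
  simp_rw [partialTranspose_tensorMap]
  exact isPositiveMap_sum _ fun x => (hD x).1.tensorMap (hE x).transposeConj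

theorem IsTwoWayLOCC.partialTranspose {L : BipartiteMap a b a' b'} (hL : IsTwoWayLOCC L) :
    IsPositiveMap (partialTranspose ∘ₗ L ∘ₗ partialTranspose) := by
  induction hL with
  | forward h => exact h.partialTranspose
  | backward h => exact h.partialTranspose
  | comp _ _ h₁ h₂ => exact fun X hX => h₂ _ (h₁ X hX)

theorem trace_partialTranspose {A B : Type} [Fintype A] [Fintype B] (X : Op (A × B)) :
    (partialTranspose X).trace = X.trace := rfl

end LOCC

/-! ### Fidelity and support projectors -/

section Fidelity

variable {ι κ : Type} [Fintype ι] [DecidableEq ι] [Fintype κ] [DecidableEq κ]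

theorem PosSemidef.trace_re_nonneg {X : Op ι} (hX : X.PosSemidef) : 0 ≤ X.trace.re :=
  (Complex.nonneg_iff.mp hX.trace_nonneg).1

theorem sqrt_posSemidef (X : Op ι) : (CFC.sqrt X).PosSemidef :=
  Matrix.nonneg_iff_posSemidef.mp (CFC.sqrt_nonneg X)

theorem fidelity_nonneg (ρ σ : Op ι) : 0 ≤ fidelity ρ σ :=
  PosSemidef.trace_re_nonneg (sqrt_posSemidef _)

theorem fidelity_self {ρ : Op ι} (hρ : ρ.PosSemidef) : fidelity ρ ρ = ρ.trace.re := by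
  have h : CFC.sqrt ρ * CFC.sqrt ρ = ρ := CFC.sqrt_mul_sqrt_self ρ hρ.nonneg
  rw [fidelity, CFC.sqrt_unique (b := ρ) _ hρ.nonneg]
  conv_lhs => rw [← h]
  simp only [mul_assoc]
  rw [← mul_assoc (CFC.sqrt ρ) (CFC.sqrt ρ) (CFC.sqrt ρ), h]

/-- With v = √X ψ of norm r, the operator under the root is |v⟩⟨v|, whose square root is |v⟩⟨v|/r
when r ≠ 0. -/
theorem fidelity_pureOp {X : Op ι} (hX : X.PosSemidef) (ψ : ι → ℂ) :
    fidelity X (pureOp ψ) = √(star ψ ⬝ᵥ X.mulVec ψ).re := by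
  set Q := CFC.sqrt X with hQ
  have hQQ : Q * Q = X := CFC.sqrt_mul_sqrt_self X hX.nonneg
  have hQh : Q.conjTranspose = Q := (sqrt_posSemidef X).1
  set v := Q.mulVec ψ with hv
  have hvv : Q * pureOp ψ * Q = Matrix.vecMulVec v (star v) := by
    rw [pureOp, Matrix.mul_vecMulVec, Matrix.vecMulVec_mul, hv, Matrix.star_mulVec, hQh]
  have hsv : star v ⬝ᵥ v = star ψ ⬝ᵥ X.mulVec ψ := by
    rw [hv, Matrix.star_mulVec, hQh, ← Matrix.dotProduct_mulVec, Matrix.mulVec_mulVec, hQQ]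
  have hnn : 0 ≤ star v ⬝ᵥ v := dotProduct_star_self_nonneg v
  obtain ⟨h1, h2⟩ := Complex.nonneg_iff.mp hnn
  set r := √(star v ⬝ᵥ v).re with hr
  have hrr : star v ⬝ᵥ v = (r : ℂ) * r := by
    rw [← Complex.ofReal_mul, Real.mul_self_sqrt h1]
    exact Complex.ext rfl h2.symm
  rw [← hsv, ← hr, fidelity, ← hQ, hvv]
  by_cases h0 : r = 0
  · have hv0 : v = 0 := by
      have h : star v ⬝ᵥ v = 0 := by rw [hrr, h0]; simp
      exact dotProduct_star_self_eq_zero.mp h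
    rw [h0, hv0]
    simp
  have hrC : (r : ℂ) ≠ 0 := by exact_mod_cast h0
  have hb : (0 : Op ι) ≤ ((r⁻¹ : ℝ) : ℂ) • Matrix.vecMulVec v (star v) := by
    refine Matrix.PosSemidef.nonneg ((Matrix.posSemidef_vecMulVec_self_star v).smul ?_)
    exact_mod_cast inv_nonneg.mpr (Real.sqrt_nonneg _)
  have hs : CFC.sqrt (Matrix.vecMulVec v (star v)) =
      ((r⁻¹ : ℝ) : ℂ) • Matrix.vecMulVec v (star v) := by
    refine CFC.sqrt_unique ?_ hb
    rw [smul_mul_smul_comm, Matrix.vecMulVec_mul_vecMulVec, hrr, Matrix.vecMulVec_smul, smul_smul]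
    push_cast
    field_simp
    simp
  rw [hs, Matrix.trace_smul, Matrix.trace_vecMulVec, dotProduct_comm, hrr,
    ← Complex.ofReal_mul, smul_eq_mul, ← Complex.ofReal_mul, Complex.ofReal_re]
  field_simp

theorem re_trace_mul_sq_le (A B : Matrix ι κ ℂ) :
    (A.conjTranspose * B).trace.re ^ 2 ≤
      (A.conjTranspose * A).trace.re * (B.conjTranspose * B).trace.re := by
  have h : ∀ t : ℝ, 0 ≤ (B.conjTranspose * B).trace.re * (t * t) +
      (2 * (A.conjTranspose * B).trace.re) * t + (A.conjTranspose * A).trace.re := fun t => by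
    have h1 := PosSemidef.trace_re_nonneg
      (Matrix.posSemidef_conjTranspose_mul_self (A + (t : ℂ) • B))
    have h2 : (B.conjTranspose * A).trace.re = (A.conjTranspose * B).trace.re := by
      rw [← Complex.conj_re, starRingEnd_apply, ← Matrix.trace_conjTranspose]
      simp
    simp only [Matrix.conjTranspose_add, Matrix.conjTranspose_smul, Matrix.add_mul, Matrix.mul_add,
      Matrix.trace_add, Complex.add_re, Matrix.smul_mul, Matrix.mul_smul, Matrix.trace_smul,
      Complex.star_def, Complex.conj_ofReal, smul_eq_mul, Complex.re_ofReal_mul, h2] at h1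
    linarith
  have := discrim_le_zero h
  rw [discrim] at this
  nlinarith

/-- The spectrum is finite, hence discrete, so the functional calculus accepts discontinuous
functions such as the indicator of x ≠ 0 and x⁻¹. -/
theorem continuousOn_spectrum (f : ℝ → ℝ) (X : Op ι) : ContinuousOn f (spectrum ℝ X) := by
  rw [continuousOn_iff_continuous_domRestrict]
  fun_prop

theorem supportProj_isHermitian (X : Op ι) : (supportProj X).conjTranspose = supportProj X :=
  cfc_predicate (R := ℝ) (p := IsSelfAdjoint) _ X

theorem supportProj_mul_self (X : Op ι) : supportProj X * supportProj X = supportProj X := by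
  rw [supportProj, ← cfc_mul _ _ X (continuousOn_spectrum _ _) (continuousOn_spectrum _ _)]
  congr 1
  ext x
  split_ifs <;> simp

theorem supportProj_mul {X : Op ι} (hX : X.IsHermitian) : supportProj X * X = X := by
  have hX' : IsSelfAdjoint X := hX
  conv_lhs => rw [← cfc_id ℝ X]
  rw [supportProj, cfc_id ℝ X]
  conv_lhs => rhs; rw [← cfc_id ℝ X]
  rw [← cfc_mul _ _ X (continuousOn_spectrum _ _) (continuousOn_spectrum _ _)]
  conv_rhs => rw [← cfc_id ℝ X]
  congr 1
  ext x
  split_ifs with h <;> simp [h]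

theorem mul_supportProj {X : Op ι} (hX : X.IsHermitian) : X * supportProj X = X := by
  have := congrArg Matrix.conjTranspose (supportProj_mul hX)
  rwa [Matrix.conjTranspose_mul, supportProj_isHermitian, hX.eq] at this

theorem exists_pseudoInverse {X : Op ι} (hX : X.IsHermitian) :
    ∃ Z : Op ι, Z.IsHermitian ∧ Z * X = supportProj X ∧ Z * supportProj X = Z := by
  have hX' : IsSelfAdjoint X := hX
  refine ⟨cfc (fun x : ℝ => x⁻¹) X, cfc_predicate (R := ℝ) (p := IsSelfAdjoint) _ X, ?_, ?_⟩
  · conv_lhs => rhs; rw [← cfc_id ℝ X]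
    rw [← cfc_mul _ _ X (continuousOn_spectrum _ _) (continuousOn_spectrum _ _), supportProj]
    congr 1
    ext x
    split_ifs with h <;> simp [h]
  · rw [supportProj, ← cfc_mul _ _ X (continuousOn_spectrum _ _) (continuousOn_spectrum _ _)]
    congr 1
    ext x
    split_ifs with h <;> simp [h]

theorem posSemidef_of_projection {P : Op ι} (h1 : P.conjTranspose = P) (h2 : P * P = P) :
    P.PosSemidef := by
  have := Matrix.posSemidef_conjTranspose_mul_self P
  rwa [h1, h2] at this

theorem posSemidef_one_sub_of_projection {P : Op ι} (h1 : P.conjTranspose = P) (h2 : P * P = P) :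
    (1 - P).PosSemidef :=
  posSemidef_of_projection (by simp [h1]) (by simp [mul_sub, sub_mul, h2])

/-- `Tr[X Y] ≥ 0` for positive semidefinite `X` and `Y`. -/
theorem trace_mul_re_nonneg {X Y : Op ι} (hX : X.PosSemidef) (hY : Y.PosSemidef) :
    0 ≤ (X * Y).trace.re := by
  have h : CFC.sqrt Y * CFC.sqrt Y = Y := CFC.sqrt_mul_sqrt_self Y hY.nonneg
  have hh : (CFC.sqrt Y).conjTranspose = CFC.sqrt Y := (sqrt_posSemidef Y).1
  have := PosSemidef.trace_re_nonneg (hX.mul_mul_conjTranspose_same (CFC.sqrt Y))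
  rwa [hh, Matrix.trace_mul_comm, ← mul_assoc, h, Matrix.trace_mul_comm] at this

/-- Write the fidelity as a Hilbert–Schmidt inner product by means of the polar partial isometry C
of √ρ' √ρ, insert the support projector next to √ρ', and apply Cauchy–Schwarz with C Cᴴ ≤ 1. -/
theorem fidelity_sq_le {ρ ρ' : Op ι} (hρ : ρ.PosSemidef) (hρ' : ρ'.PosSemidef) :
    fidelity ρ ρ' ^ 2 ≤ (supportProj ρ' * ρ).trace.re * ρ'.trace.re := by
  set P := CFC.sqrt ρ with hP
  set Q := CFC.sqrt ρ' with hQ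
  set S := supportProj ρ' with hS
  have hPP : P * P = ρ := CFC.sqrt_mul_sqrt_self ρ hρ.nonneg
  have hPh : P.conjTranspose = P := (sqrt_posSemidef ρ).1
  have hQQ : Q * Q = ρ' := CFC.sqrt_mul_sqrt_self ρ' hρ'.nonneg
  have hQh : Q.conjTranspose = Q := (sqrt_posSemidef ρ').1
  have hXX : (0 : Op ι) ≤ P * ρ' * P := by
    have := (hρ'.mul_mul_conjTranspose_same P).nonneg
    rwa [hPh] at this
  set N := CFC.sqrt (P * ρ' * P) with hN
  have hNN : N * N = P * ρ' * P := CFC.sqrt_mul_sqrt_self _ hXX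
  have hNh : N.IsHermitian := (sqrt_posSemidef _).1
  obtain ⟨Z, hZh, hZN, hZS⟩ := exists_pseudoInverse hNh
  have hZNN : Z * (P * ρ' * P) = N := by
    rw [← hNN, ← mul_assoc, hZN, supportProj_mul hNh]
  set C := Q * P * Z with hC
  have hCh : C.conjTranspose = Z * P * Q := by
    rw [hC, Matrix.conjTranspose_mul, Matrix.conjTranspose_mul, hQh, hPh, hZh.eq, mul_assoc]
  have hNZ : N * Z = supportProj N := by
    have := congrArg Matrix.conjTranspose hZN
    rwa [Matrix.conjTranspose_mul, supportProj_isHermitian, hNh.eq, hZh.eq] at this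
  have hCC : C.conjTranspose * C = supportProj N := by
    rw [hCh, hC]
    calc Z * P * Q * (Q * P * Z) = Z * (P * (Q * Q) * P) * Z := by simp only [mul_assoc]
      _ = supportProj N := by rw [hQQ, hZNN, hNZ]
  have hCproj : (C * C.conjTranspose) * (C * C.conjTranspose) = C * C.conjTranspose := by
    calc (C * C.conjTranspose) * (C * C.conjTranspose)
        = C * (C.conjTranspose * C) * C.conjTranspose := by simp only [mul_assoc]
      _ = Q * P * (Z * supportProj N) * C.conjTranspose := by rw [hCC, hC]; simp only [mul_assoc]
      _ = C * C.conjTranspose := by rw [hZS]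
  have hle := posSemidef_one_sub_of_projection (P := C * C.conjTranspose) (by simp) hCproj
  have h1 : (Q * C * (Q * C).conjTranspose).trace.re ≤ ρ'.trace.re := by
    have := PosSemidef.trace_re_nonneg (hle.mul_mul_conjTranspose_same Q)
    rw [mul_sub, sub_mul, Matrix.trace_sub, Complex.sub_re, mul_one, hQh, hQQ, sub_nonneg] at this
    refine le_trans (le_of_eq ?_) this
    rw [Matrix.conjTranspose_mul, hQh]
    simp only [mul_assoc]
  have h2 : ((S * P).conjTranspose * (S * P)).trace.re = (S * ρ).trace.re := by
    rw [Matrix.conjTranspose_mul, hPh, supportProj_isHermitian, mul_assoc, Matrix.trace_mul_comm,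
      ← mul_assoc, supportProj_mul_self, mul_assoc, hPP]
  have h3 : fidelity ρ ρ' = ((Q * C).conjTranspose * (S * P)).trace.re := by
    have : (Q * C).conjTranspose * (S * P) = N := by
      rw [Matrix.conjTranspose_mul, hCh, hQh, ← hZNN]
      conv_rhs => rw [← mul_supportProj hρ'.1, ← hQQ]
      simp only [mul_assoc, hS]
      rw [← hQQ]
    rw [this]; rfl
  have h4 := re_trace_mul_sq_le (Q * C) (S * P)
  rw [← h3, h2, Matrix.trace_mul_comm (Q * C).conjTranspose] at h4
  refine h4.trans ?_
  rw [mul_comm]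
  refine mul_le_mul_of_nonneg_left h1 ?_
  exact trace_mul_re_nonneg (posSemidef_of_projection (supportProj_isHermitian _)
    (supportProj_mul_self _)) hρ

/-- An algebraic characterization, so that support projectors can be relabelled without transporting
the functional calculus. -/
theorem supportProj_unique {X P : Op ι} (hX : X.IsHermitian) (h1 : P.conjTranspose = P)
    (h2 : P * X = X) (h3 : ∃ Y, P = X * Y) : supportProj X = P := by
  obtain ⟨Y, hY⟩ := h3
  obtain ⟨Z, -, hZ, -⟩ := exists_pseudoInverse hX
  have h4 : supportProj X * P = P := by rw [hY, ← mul_assoc, supportProj_mul hX]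
  have h5 : supportProj X * P = supportProj X := by
    have h6 : X * P = X := by
      have := congrArg Matrix.conjTranspose h2
      rwa [Matrix.conjTranspose_mul, h1, hX.eq] at this
    rw [← hZ, mul_assoc, h6]
  rw [← h5, h4]

/-! ### Relabelling -/

variable (e : ι ≃ κ)

theorem sqrt_submatrix {X : Op κ} (hX : X.PosSemidef) :
    CFC.sqrt (X.submatrix e e) = (CFC.sqrt X).submatrix e e := by
  refine CFC.sqrt_unique ?_ ((sqrt_posSemidef X).submatrix e).nonneg
  rw [Matrix.submatrix_mul_equiv, CFC.sqrt_mul_sqrt_self X hX.nonneg]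

theorem trace_submatrix (X : Op κ) : (X.submatrix e e).trace = X.trace :=
  Equiv.sum_comp e fun i => X i i

theorem fidelity_submatrix {X Y : Op κ} (hX : X.PosSemidef) (hY : Y.PosSemidef) :
    fidelity (X.submatrix e e) (Y.submatrix e e) = fidelity X Y := by
  have h := hY.mul_mul_conjTranspose_same (CFC.sqrt X)
  rw [(sqrt_posSemidef X).1.eq] at h
  rw [fidelity, sqrt_submatrix e hX, Matrix.submatrix_mul_equiv, Matrix.submatrix_mul_equiv,
    sqrt_submatrix e h, trace_submatrix, fidelity]

theorem supportProj_submatrix {X : Op κ} (hX : X.IsHermitian) :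
    supportProj (X.submatrix e e) = (supportProj X).submatrix e e := by
  refine supportProj_unique (hX.submatrix e) ?_ ?_ ?_
  · rw [Matrix.conjTranspose_submatrix, supportProj_isHermitian]
  · rw [Matrix.submatrix_mul_equiv, supportProj_mul hX]
  · obtain ⟨Z, hZh, hZ, -⟩ := exists_pseudoInverse hX
    refine ⟨Z.submatrix e e, ?_⟩
    have := congrArg Matrix.conjTranspose hZ
    rw [Matrix.conjTranspose_mul, supportProj_isHermitian, hZh.eq, hX.eq] at this
    rw [Matrix.submatrix_mul_equiv, this]

theorem submatrix_mem_smoothBall {ρ ρ' : Op κ} (hρ : ρ.PosSemidef) {δ : ℝ}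
    (h : ρ' ∈ smoothBall ρ δ) : ρ'.submatrix e e ∈ smoothBall (ρ.submatrix e e) δ := by
  obtain ⟨h1, h2, h3⟩ := h
  refine ⟨h1.submatrix e, by rwa [trace_submatrix], by rwa [fidelity_submatrix e hρ h1]⟩

theorem isState_submatrix {σ : Op κ} (hσ : IsState σ) : IsState (σ.submatrix e e) :=
  ⟨hσ.1.submatrix e, by rw [trace_submatrix, hσ.2]⟩

theorem zeroCohInfo_le_submatrix {A : Type} [Fintype A] [DecidableEq A] {ρ : Op (A × κ)}
    (hρ : ρ.PosSemidef) (δ : ℝ) :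
    zeroCohInfo δ ρ ≤
      zeroCohInfo δ (ρ.submatrix (Equiv.prodCongr (Equiv.refl A) e)
        (Equiv.prodCongr (Equiv.refl A) e)) := by
  set f := Equiv.prodCongr (Equiv.refl A) e with hf
  refine iSup₂_le fun ρ' hρ' => ?_
  refine le_iSup₂_of_le (ρ'.submatrix f f) (submatrix_mem_smoothBall f hρ hρ') ?_
  refine le_iInf₂ fun τ hτ => ?_
  refine (iInf₂_le (τ.submatrix e.symm e.symm) (isState_submatrix e.symm hτ)).trans (le_of_eq ?_)
  have h : (1 : Op A) ⊗ₖ τ =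
      ((1 : Op A) ⊗ₖ (τ.submatrix e.symm e.symm)).submatrix f f := by
    ext p q
    simp [hf]
    exact Or.inl rfl
  rw [relEntropyZero, relEntropyZero, h, supportProj_submatrix f hρ'.1.1,
    Matrix.submatrix_mul_equiv, trace_submatrix]

end Fidelity

/-! ### Random hashing with random phases -/

section RandomHash

variable {A : Type} [Fintype A] [DecidableEq A]

/-- A hash function `A → Fin M` together with a phase (a cube root of unity) for each point. -/
abbrev HashPhase (A : Type) (M : ℕ) : Type := (A → Fin M) × (A → ZMod 3)

/-- The standard additive character of `ZMod 3`. -/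
abbrev phaseChar : AddChar (ZMod 3) ℂ := ZMod.stdAddChar

theorem sum_phaseChar_eq_zero (f : (A → ZMod 3) →+ ZMod 3) {x : A → ZMod 3} (hx : f x ≠ 0) :
    ∑ t, phaseChar (f t) = 0 := by
  have h : phaseChar.compAddMonoidHom f ≠ 1 := by
    intro h
    have h1 : phaseChar (f x) = 1 := DFunLike.congr_fun h x
    exact hx (ZMod.injective_stdAddChar (h1.trans (AddChar.map_zero_eq_one _).symm))
  exact AddChar.sum_eq_zero_of_ne_one h

theorem sum_phaseChar_sub (a c : A) :
    ∑ t : A → ZMod 3, phaseChar (t c - t a) =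
      if a = c then (Fintype.card (A → ZMod 3) : ℂ) else 0 := by
  split_ifs with h
  · subst h; simp
  · obtain ⟨f, hf⟩ : ∃ f : (A → ZMod 3) →+ ZMod 3, ∀ t, f t = t c - t a :=
      ⟨AddMonoidHom.mk' (fun t => t c - t a) fun s t => by
        simp only [Pi.add_apply]; abel, fun _ => rfl⟩
    simp_rw [← hf]
    refine sum_phaseChar_eq_zero f (x := Pi.single c 1) ?_
    rw [hf]
    simp [h]

/-- The exponent is a homomorphism in t, so the character sum vanishes unless the exponent does
identically. Cube roots of unity leave only the two pairings; signs would also allow a = c, b = e.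
-/
theorem sum_phaseChar_sub_add_sub (a b c e : A) :
    ∑ t : A → ZMod 3, phaseChar ((t e - t a) + (t b - t c)) =
      if (a = e ∧ c = b) ∨ (a = b ∧ c = e) then (Fintype.card (A → ZMod 3) : ℂ) else 0 := by
  split_ifs with h
  · obtain ⟨rfl, rfl⟩ | ⟨rfl, rfl⟩ := h <;> simp
  · obtain ⟨f, hf'⟩ : ∃ f : (A → ZMod 3) →+ ZMod 3, ∀ t, f t = (t e - t a) + (t b - t c) :=
      ⟨AddMonoidHom.mk' (fun t => (t e - t a) + (t b - t c)) fun s t => by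
        simp only [Pi.add_apply]; abel, fun _ => rfl⟩
    simp_rw [← hf']
    suffices hj : ∃ j, f (Pi.single j 1) ≠ 0 from sum_phaseChar_eq_zero f hj.choose_spec
    have hf (j : A) : f (Pi.single j 1) = (((if e = j then 1 else 0) - (if a = j then 1 else 0)) +
        ((if b = j then 1 else 0) - (if c = j then 1 else 0)) : ZMod 3) := by
      rw [hf']; simp only [Pi.single_apply]
    push Not at h
    by_cases hae : a = e
    · refine ⟨b, ?_⟩
      rw [hf, if_neg (h.1 hae), hae]
      simp
    · by_cases hab : a = b
      · refine ⟨e, ?_⟩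
        rw [hf, if_neg hae, if_neg (h.2 hab), ← hab, if_neg hae]
        simp
      · refine ⟨a, ?_⟩
        rw [hf, if_neg (Ne.symm hae), if_neg (Ne.symm hab)]
        -- If also c = a, the value is -1 - 1, which is nonzero modulo 3 but would vanish modulo 2.
        by_cases hca : c = a <;> simp [hca]
        decide

variable {M : ℕ} [NeZero M]

/-- Shifting f at c by j permutes the hash functions, so all M differences between the two buckets
are equally frequent. -/
theorem sum_hash_collision {a c : A} (h : a ≠ c) :
    (M : ℂ) * ∑ f : A → Fin M, (if f a = f c then 1 else 0) = (Fintype.card (A → Fin M) : ℂ) := by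
  have h1 (j : Fin M) : ∑ f : A → Fin M, (if f a = f c then (1 : ℂ) else 0) =
      ∑ f : A → Fin M, (if f a = f c + j then 1 else 0) := by
    refine (Equiv.sum_comp (Equiv.addRight (Pi.single c j : A → Fin M))
      (fun f => if f a = f c then (1 : ℂ) else 0)).symm.trans ?_
    simp [h]
  have h2 : ∑ j : Fin M, ∑ f : A → Fin M, (if f a = f c + j then (1 : ℂ) else 0) =
      (Fintype.card (A → Fin M) : ℂ) := by
    rw [Finset.sum_comm]
    have (f : A → Fin M) : ∑ j : Fin M, (if f a = f c + j then (1 : ℂ) else 0) = 1 := by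
      simp_rw [← sub_eq_iff_eq_add']
      simp
    simp [this]
  rw [← h2, ← Finset.sum_congr rfl fun j _ => h1 j]
  simp

theorem sum_prod_mul {X Y : Type*} [Fintype X] [Fintype Y] (u : X → ℂ) (v : Y → ℂ) :
    ∑ p : X × Y, u p.1 * v p.2 = (∑ x, u x) * ∑ y, v y := by
  rw [Fintype.sum_prod_type, Finset.sum_mul_sum]

/-- The Gram matrix of the random vectors attached to the points of `A`. -/
def hashGram (g : HashPhase A M) (a c : A) : ℂ :=
  (if g.1 a = g.1 c then 1 else 0) * phaseChar (g.2 c - g.2 a)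

theorem sum_hashGram (a c : A) :
    ∑ g : HashPhase A M, hashGram g a c =
      if a = c then (Fintype.card (HashPhase A M) : ℂ) else 0 := by
  refine (sum_prod_mul (fun f : A → Fin M => if f a = f c then (1 : ℂ) else 0)
    (fun t : A → ZMod 3 => phaseChar (t c - t a))).trans ?_
  rw [sum_phaseChar_sub]
  split_ifs with h
  · subst h; simp
  · simp

/-- The pairing a = e, c = b always has matching buckets; the crossed pairing needs a collision, of
probability 1/M. Their overlap a = c is counted in the first only. -/
theorem sum_hashGram_mul (a b c e : A) :
    ∑ g : HashPhase A M, hashGram g a e * hashGram g c b =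
      (Fintype.card (HashPhase A M) : ℂ) *
        ((if a = e ∧ c = b then 1 else 0) +
          (M : ℂ)⁻¹ * if a = b ∧ c = e ∧ a ≠ c then 1 else 0) := by
  have hM : (M : ℂ) ≠ 0 := Nat.cast_ne_zero.mpr (NeZero.ne M)
  have h (g : HashPhase A M) : hashGram g a e * hashGram g c b =
      (if g.1 a = g.1 e ∧ g.1 c = g.1 b then 1 else 0) *
        phaseChar ((g.2 e - g.2 a) + (g.2 b - g.2 c)) := by
    rw [hashGram, hashGram, AddChar.map_add_eq_mul]
    split_ifs <;> simp_all
  rw [Finset.sum_congr rfl fun g _ => h g]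
  refine (sum_prod_mul (fun f : A → Fin M => if f a = f e ∧ f c = f b then (1 : ℂ) else 0)
    (fun t : A → ZMod 3 => phaseChar ((t e - t a) + (t b - t c)))).trans ?_
  rw [sum_phaseChar_sub_add_sub]
  have hc : (Fintype.card (HashPhase A M) : ℂ) =
      Fintype.card (A → Fin M) * Fintype.card (A → ZMod 3) := by
    rw [Fintype.card_prod]; push_cast; rfl
  rw [hc]
  by_cases h1 : a = e ∧ c = b
  · obtain ⟨rfl, rfl⟩ := h1
    by_cases h2 : a = c <;> simp [h2]
  · by_cases h2 : a = b ∧ c = e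
    · obtain ⟨rfl, rfl⟩ := h2
      have hac : a ≠ c := fun h => h1 ⟨h, h.symm⟩
      rw [← sum_hash_collision hac]
      have (f : A → Fin M) : (f a = f c ∧ f c = f a) ↔ f a = f c := ⟨And.left, fun h => ⟨h, h.symm⟩⟩
      simp only [this]
      rw [if_pos (Or.inr ⟨trivial, trivial⟩), if_neg h1, if_pos ⟨trivial, trivial, hac⟩]
      field_simp
      ring
    · rw [if_neg (not_or.mpr ⟨h1, h2⟩), if_neg h1, if_neg fun h => h2 ⟨h.1, h.2.1⟩]
      simp

end RandomHash

/-! ### The hashed operators and the rational decoder -/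

section Decoder

variable {A B F : Type} [Fintype A] [DecidableEq A] [Fintype B] [DecidableEq B] [Fintype F]
  [DecidableEq F] {M : ℕ} [NeZero M]

/-- The random vectors attached to the points of `A`. -/
def hashVec (g : HashPhase A M) (a : A) (i : Fin M) : ℂ :=
  (if g.1 a = i then 1 else 0) * phaseChar (g.2 a)

theorem star_phaseChar_mul (x y : ZMod 3) :
    star (phaseChar x) * phaseChar y = phaseChar (y - x) := by
  rw [Complex.star_def, ← AddChar.map_neg_eq_conj, ← AddChar.map_add_eq_mul, neg_add_eq_sub]

theorem sum_hashVec (g : HashPhase A M) (a c : A) :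
    ∑ i, star (hashVec g a i) * hashVec g c i = hashGram g a c := by
  have h (i : Fin M) : star (hashVec g a i) * hashVec g c i =
      (if g.1 a = i ∧ g.1 c = i then 1 else 0) * phaseChar (g.2 c - g.2 a) := by
    rw [hashVec, hashVec, ← star_phaseChar_mul, star_mul']
    split_ifs <;> simp_all
  simp_rw [h, ← Finset.sum_mul, hashGram]
  congr 1
  by_cases hac : g.1 a = g.1 c
  · simp [hac]
  · rw [if_neg hac]
    refine Finset.sum_eq_zero fun i _ => if_neg fun h => hac (h.1.trans h.2.symm)

/-- The operators `N a` hashed to `M` buckets, with phases. -/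
def hashed (N : A → Matrix B F ℂ) (g : HashPhase A M) (i : Fin M) : Matrix B F ℂ :=
  ∑ a, hashVec g a i • N a

/-- `∑ᵢ Yᵢ Yᵢᴴ` for the hashed operators `Yᵢ`, rescaled by `M`. -/
def hashedCov (N : A → Matrix B F ℂ) (g : HashPhase A M) : Op B :=
  (M : ℂ) • ∑ i, hashed N g i * (hashed N g i).conjTranspose

variable (N : A → Matrix B F ℂ)

theorem sum_hashed_conj_mul_of_mul (g : HashPhase A M) (X : Op B) :
    ∑ i, (hashed N g i).conjTranspose * X * hashed N g i =
      ∑ a, ∑ c, hashGram g a c • ((N a).conjTranspose * X * N c) := by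
  have h (i : Fin M) : (hashed N g i).conjTranspose * X * hashed N g i =
      ∑ a, ∑ c, (star (hashVec g a i) * hashVec g c i) •
        ((N a).conjTranspose * X * N c) := by
    simp only [hashed, Matrix.conjTranspose_sum, Matrix.conjTranspose_smul, Matrix.sum_mul]
    refine Finset.sum_congr rfl fun a _ => ?_
    simp only [Matrix.mul_sum]
    refine Finset.sum_congr rfl fun c _ => ?_
    rw [Matrix.smul_mul, Matrix.smul_mul, Matrix.mul_smul, smul_smul]
  simp_rw [h]
  rw [Finset.sum_comm]
  refine Finset.sum_congr rfl fun a _ => ?_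
  rw [Finset.sum_comm]
  refine Finset.sum_congr rfl fun c _ => ?_
  rw [← Finset.sum_smul, sum_hashVec]

theorem sum_hashed_conj_mul (g : HashPhase A M) :
    ∑ i, (hashed N g i).conjTranspose * hashed N g i =
      ∑ a, ∑ c, hashGram g a c • ((N a).conjTranspose * N c) := by
  simpa using sum_hashed_conj_mul_of_mul N g 1

theorem sum_hashed_mul_conj (g : HashPhase A M) :
    ∑ i, hashed N g i * (hashed N g i).conjTranspose =
      ∑ b, ∑ c, hashGram g c b • (N b * (N c).conjTranspose) := by
  have h (i : Fin M) : hashed N g i * (hashed N g i).conjTranspose =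
      ∑ b, ∑ c, (star (hashVec g c i) * hashVec g b i) • (N b * (N c).conjTranspose) := by
    simp only [hashed, Matrix.conjTranspose_sum, Matrix.conjTranspose_smul, Matrix.sum_mul]
    refine Finset.sum_congr rfl fun a _ => ?_
    simp only [Matrix.mul_sum]
    refine Finset.sum_congr rfl fun c _ => ?_
    rw [Matrix.smul_mul, Matrix.mul_smul, smul_smul, mul_comm]
  simp_rw [h]
  rw [Finset.sum_comm]
  refine Finset.sum_congr rfl fun a _ => ?_
  rw [Finset.sum_comm]
  refine Finset.sum_congr rfl fun c _ => ?_
  rw [← Finset.sum_smul, sum_hashVec]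

theorem sum_hashed_conj_mul_mul (g : HashPhase A M) :
    ∑ i, (hashed N g i).conjTranspose * hashedCov N g * hashed N g i =
      (M : ℂ) • ∑ a, ∑ e, ∑ b, ∑ c, (hashGram g a e * hashGram g c b) •
        ((N a).conjTranspose * (N b * (N c).conjTranspose) * N e) := by
  rw [sum_hashed_conj_mul_of_mul, hashedCov, sum_hashed_mul_conj]
  simp_rw [Matrix.mul_smul, Matrix.smul_mul, Matrix.mul_sum, Matrix.sum_mul, Matrix.mul_smul,
    Matrix.smul_mul, smul_comm _ (M : ℂ), ← Finset.smul_sum, Finset.smul_sum (r := hashGram _ _ _),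
    smul_smul]

theorem sum_sum_hashed_conj_mul :
    ∑ g : HashPhase A M, ∑ i, (hashed N g i).conjTranspose * hashed N g i =
      (Fintype.card (HashPhase A M) : ℂ) • ∑ a, (N a).conjTranspose * N a := by
  simp_rw [sum_hashed_conj_mul]
  rw [Finset.sum_comm, Finset.smul_sum]
  refine Finset.sum_congr rfl fun a _ => ?_
  rw [Finset.sum_comm]
  simp_rw [← Finset.sum_smul, sum_hashGram, ite_smul, zero_smul]
  simp

theorem sum_sum_hashed_conj_mul_mul :
    ∑ g : HashPhase A M, ∑ i, (hashed N g i).conjTranspose * hashedCov N g * hashed N g i =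
      ((M : ℂ) * (Fintype.card (HashPhase A M) : ℂ)) •
        (∑ a, ∑ c, (N a).conjTranspose * (N c * (N c).conjTranspose) * N a + (M : ℂ)⁻¹ •
          ((∑ a, (N a).conjTranspose * N a) * (∑ a, (N a).conjTranspose * N a) -
            ∑ a, ((N a).conjTranspose * N a) * ((N a).conjTranspose * N a))) := by
  simp_rw [sum_hashed_conj_mul_mul]
  rw [← Finset.smul_sum, mul_smul]
  congr 1
  have h (a e b c : A) : ∑ g : HashPhase A M, (hashGram g a e * hashGram g c b) •
        ((N a).conjTranspose * (N b * (N c).conjTranspose) * N e) =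
      (Fintype.card (HashPhase A M) : ℂ) •
        ((if a = e ∧ c = b then (N a).conjTranspose * (N b * (N c).conjTranspose) * N e else 0) +
          (M : ℂ)⁻¹ • if a = b ∧ c = e ∧ a ≠ c then
            (N a).conjTranspose * (N b * (N c).conjTranspose) * N e else 0) := by
    rw [← Finset.sum_smul, sum_hashGram_mul, mul_smul, add_smul, mul_smul, ite_smul, ite_smul]
    simp
  have h' : ∑ g : HashPhase A M, ∑ a, ∑ e, ∑ b, ∑ c, (hashGram g a e * hashGram g c b) •
        ((N a).conjTranspose * (N b * (N c).conjTranspose) * N e) =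
      ∑ a, ∑ e, ∑ b, ∑ c, ∑ g : HashPhase A M, (hashGram g a e * hashGram g c b) •
        ((N a).conjTranspose * (N b * (N c).conjTranspose) * N e) := by
    rw [Finset.sum_comm]
    refine Finset.sum_congr rfl fun a _ => ?_
    rw [Finset.sum_comm]
    refine Finset.sum_congr rfl fun e _ => ?_
    rw [Finset.sum_comm]
    refine Finset.sum_congr rfl fun b _ => ?_
    rw [Finset.sum_comm]
  rw [h']
  simp_rw [h, ← Finset.smul_sum, Finset.sum_add_distrib, ← Finset.smul_sum]
  congr 2
  · refine Finset.sum_congr rfl fun a _ => ?_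
    rw [Finset.sum_eq_single a (fun e _ he => by simp [Ne.symm he]) (by simp)]
    simp
  · congr 1
    rw [Finset.sum_mul_sum, ← Finset.sum_sub_distrib]
    refine Finset.sum_congr rfl fun a _ => ?_
    rw [← Finset.sum_erase_eq_sub (Finset.mem_univ a)]
    refine Eq.trans (Finset.sum_erase (a := a) _ ?_).symm ?_
    · exact Finset.sum_eq_zero fun b _ => Finset.sum_eq_zero fun c _ =>
        if_neg fun h => h.2.2 h.2.1.symm
    refine Finset.sum_congr rfl fun e he => ?_
    rw [Finset.sum_eq_single a (fun b _ hb => by simp [Ne.symm hb]) (by simp),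
      Finset.sum_eq_single e (fun c _ hc => by simp [hc]) (by simp),
      if_pos ⟨rfl, rfl, (Finset.ne_of_mem_erase he).symm⟩]
    simp only [Matrix.mul_assoc]

/-- In the exact fourth moment, `hκ` bounds the uncrossed part by κP, idempotence makes the crossed
part P/M, and the remaining diagonal term has a favourable sign. -/
theorem posSemidef_second_moment {κ : ℝ}
    (hP : (∑ a, (N a).conjTranspose * N a) * (∑ a, (N a).conjTranspose * N a) =
      ∑ a, (N a).conjTranspose * N a)
    (hκ : ((κ : ℂ) • (1 : Op B) - ∑ a, N a * (N a).conjTranspose).PosSemidef) :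
    (((M * Fintype.card (HashPhase A M) * (κ + (M : ℝ)⁻¹) : ℝ) : ℂ) •
        ∑ a, (N a).conjTranspose * N a -
      ∑ g : HashPhase A M, ∑ i,
        (hashed N g i).conjTranspose * hashedCov N g * hashed N g i).PosSemidef := by
  rw [sum_sum_hashed_conj_mul_mul, hP]
  have h1 : (∑ a, (N a).conjTranspose * ((κ : ℂ) • (1 : Op B) - ∑ a, N a * (N a).conjTranspose) *
      N a).PosSemidef :=
    Matrix.posSemidef_sum _ fun a _ => hκ.conjTranspose_mul_mul_same (N a)
  have h2 : (∑ a, ((N a).conjTranspose * N a) * ((N a).conjTranspose * N a)).PosSemidef := by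
    refine Matrix.posSemidef_sum _ fun a _ => ?_
    have := Matrix.posSemidef_conjTranspose_mul_self ((N a).conjTranspose * N a)
    simpa using this
  have h3 := (h1.add (h2.smul (a := ((M : ℝ)⁻¹ : ℝ)) (by positivity))).smul
    (a := (M * Fintype.card (HashPhase A M) : ℝ)) (by positivity)
  convert h3 using 1
  simp only [Matrix.mul_sub, Matrix.sub_mul, Matrix.mul_smul, Matrix.smul_mul, Matrix.mul_one,
    Finset.sum_sub_distrib, ← Finset.smul_sum, Matrix.mul_sum, Matrix.sum_mul,
    RCLike.real_smul_eq_coe_smul (K := ℂ)]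
  push_cast
  module

/-- The decoding operators `2 Yᵢᴴ (1 + ∑ⱼ Yⱼ Yⱼᴴ)⁻¹`, up to normalization. -/
def decoder (g : HashPhase A M) (i : Fin M) : Matrix F B ℂ :=
  (2 : ℂ) • ((hashed N g i).conjTranspose * (1 + hashedCov N g)⁻¹)

theorem hashedCov_posSemidef (g : HashPhase A M) : (hashedCov N g).PosSemidef := by
  refine (Matrix.posSemidef_sum _ fun i _ =>
    Matrix.posSemidef_self_mul_conjTranspose (hashed N g i)).smul ?_
  exact Nat.cast_nonneg M

theorem one_add_hashedCov_posDef (g : HashPhase A M) : (1 + hashedCov N g).PosDef :=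
  Matrix.PosDef.one.add_posSemidef (hashedCov_posSemidef N g)

/-- With G = (1 + W)⁻¹ the difference is G (1 - W)² G, since 4W = (1 + W)² - (1 - W)². -/
theorem posSemidef_one_sub_decoder (g : HashPhase A M) :
    (1 - (M : ℂ) • ∑ i, (decoder N g i).conjTranspose * decoder N g i).PosSemidef := by
  have hG := one_add_hashedCov_posDef N g
  have hW := (hashedCov_posSemidef N g).1
  have hGh := hG.inv.1
  have hu := (Matrix.isUnit_iff_isUnit_det _).mp hG.isUnit
  have h1 := Matrix.mul_nonsing_inv _ hu
  have h2 := Matrix.nonsing_inv_mul _ hu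
  have hs : (M : ℂ) • ∑ i, (decoder N g i).conjTranspose * decoder N g i =
      (4 : ℂ) • ((1 + hashedCov N g)⁻¹ * hashedCov N g * (1 + hashedCov N g)⁻¹) := by
    simp only [decoder, Matrix.conjTranspose_smul, Matrix.conjTranspose_mul, hGh.eq,
      Matrix.conjTranspose_conjTranspose, Matrix.smul_mul, Matrix.mul_smul, smul_smul]
    set G := (1 + hashedCov N g)⁻¹
    rw [hashedCov, Matrix.mul_smul, Matrix.smul_mul, smul_comm, ← Finset.smul_sum, Matrix.mul_sum,
      Matrix.sum_mul]
    simp only [Matrix.mul_assoc, Complex.star_def, Complex.conj_ofNat]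
    norm_num
  rw [hs]
  set W := hashedCov N g
  set G := (1 + W)⁻¹
  have h3 : (1 - (4 : ℂ) • (G * W * G)) =
      G.conjTranspose * ((1 - W).conjTranspose * (1 - W)) * G := by
    rw [hGh.eq, Matrix.conjTranspose_sub, Matrix.conjTranspose_one, hW.eq]
    have : (1 : Op B) = G * ((1 + W) * (1 + W)) * G := by
      rw [← mul_assoc, h2, one_mul, h1]
    conv_lhs => lhs; rw [this]
    rw [← Matrix.smul_mul, ← Matrix.mul_smul, ← sub_mul, ← mul_sub]
    congr 2
    noncomm_ring
    module
  rw [h3]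
  exact (Matrix.posSemidef_conjTranspose_mul_self _).conjTranspose_mul_mul_same _

/-- The line (3 - w)/2 is the tangent to the convex function 2/(1 + w) at w = 1, with error (1 -
w)²/(2(1 + w)). Being affine in W, it makes the average over hashes computable. -/
theorem posSemidef_decoder_mul (g : HashPhase A M) (i : Fin M) :
    (decoder N g i * hashed N g i - ((1 / 2 : ℝ) : ℂ) • ((3 : ℂ) • ((hashed N g i).conjTranspose *
      hashed N g i) - (hashed N g i).conjTranspose * hashedCov N g * hashed N g i)).PosSemidef := by
  have hG := one_add_hashedCov_posDef N g
  have hW := (hashedCov_posSemidef N g).1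
  have hu := (Matrix.isUnit_iff_isUnit_det _).mp hG.isUnit
  have h1 := Matrix.mul_nonsing_inv _ hu
  have h2 := Matrix.nonsing_inv_mul _ hu
  rw [decoder]
  have hGi := hG.inv.posSemidef
  set W := hashedCov N g
  set G := (1 + W)⁻¹
  set Y := hashed N g i
  have hGW : G * W = 1 - G := by rw [eq_sub_iff_add_eq, add_comm, ← h2, mul_add, mul_one]
  have hWG : W * G = 1 - G := by rw [eq_sub_iff_add_eq, add_comm, ← h1, add_mul, one_mul]
  have h3 : (2 : ℂ) • (Y.conjTranspose * G) * Y - ((1 / 2 : ℝ) : ℂ) •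
      ((3 : ℂ) • (Y.conjTranspose * Y) - Y.conjTranspose * W * Y) =
      (1 / 2 : ℝ) • (((1 - W) * Y).conjTranspose * G * ((1 - W) * Y)) := by
    have h4 : (1 - W) * G * (1 - W) = (4 : ℂ) • G - (3 : ℂ) • 1 + W := by
      rw [sub_mul, one_mul, hWG]
      simp only [mul_sub, sub_mul, one_mul, mul_one, hGW]
      module
    have h5 : ((1 - W) * Y).conjTranspose * G * ((1 - W) * Y) =
        Y.conjTranspose * ((1 - W) * G * (1 - W)) * Y := by
      rw [Matrix.conjTranspose_mul, Matrix.conjTranspose_sub, Matrix.conjTranspose_one, hW.eq]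
      simp only [Matrix.mul_assoc]
    rw [h5, h4]
    simp only [Matrix.mul_add, Matrix.mul_sub, Matrix.add_mul, Matrix.sub_mul, Matrix.mul_smul,
      Matrix.smul_mul, Matrix.mul_one, RCLike.real_smul_eq_coe_smul (K := ℂ)]
    push_cast
    module
  rw [h3]
  exact (hGi.conjTranspose_mul_mul_same _).smul (by norm_num)

/-- Averaging the tangent bound gives the factor (3 - (Mκ + 1))/2 = 1 - Mκ/2. -/
theorem le_trace_decoder {κ : ℝ}
    (hP : (∑ a, (N a).conjTranspose * N a) * (∑ a, (N a).conjTranspose * N a) =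
      ∑ a, (N a).conjTranspose * N a)
    (hκ : ((κ : ℂ) • (1 : Op B) - ∑ a, N a * (N a).conjTranspose).PosSemidef)
    {ρ : Op F} (hρ : ρ.PosSemidef) :
    Fintype.card (HashPhase A M) * (1 - M * κ / 2) *
        ((∑ a, (N a).conjTranspose * N a) * ρ).trace.re ≤
      ((∑ g : HashPhase A M, ∑ i, decoder N g i * hashed N g i) * ρ).trace.re := by
  have h1 := trace_mul_re_nonneg (posSemidef_second_moment (M := M) N hP hκ) hρ
  have h2 := trace_mul_re_nonneg (Matrix.posSemidef_sum Finset.univ fun g _ =>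
    Matrix.posSemidef_sum Finset.univ fun i _ => posSemidef_decoder_mul (M := M) N g i) hρ
  simp only [Finset.sum_sub_distrib, ← Finset.smul_sum] at h2
  rw [sum_sum_hashed_conj_mul] at h2
  simp only [sub_mul, Matrix.smul_mul, Matrix.trace_sub, Matrix.trace_smul, Complex.sub_re,
    smul_eq_mul, Complex.re_ofReal_mul] at h1 h2
  have hM : (M : ℝ) ≠ 0 := Nat.cast_ne_zero.mpr (NeZero.ne M)
  have h3 (z : ℂ) : ((3 : ℂ) * ((Fintype.card (HashPhase A M) : ℂ) * z)).re =
      3 * (Fintype.card (HashPhase A M) * z.re) := by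
    rw [← Complex.ofReal_natCast, ← Complex.ofReal_ofNat, Complex.re_ofReal_mul,
      Complex.re_ofReal_mul]
  rw [h3] at h2
  have h4 : (M : ℝ) * Fintype.card (HashPhase A M) * (κ + (M : ℝ)⁻¹) =
      Fintype.card (HashPhase A M) * (M * κ + 1) := by field_simp
  rw [h4] at h1
  linarith

end Decoder

/-! ### The hashing protocol -/

section Protocol

theorem dotProduct_mulVec_eq_trace {ι : Type} [Fintype ι] (X : Op ι) (ψ : ι → ℂ) :
    star ψ ⬝ᵥ X.mulVec ψ = (X * pureOp ψ).trace := by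
  rw [pureOp, Matrix.mul_vecMulVec, Matrix.trace_vecMulVec, dotProduct_comm]

theorem trace_kraus {A A' : Type} [Fintype A] [DecidableEq A] [Fintype A'] [DecidableEq A']
    (V : Matrix A' A ℂ) (X : Op A) :
    (kraus V X).trace = (V.conjTranspose * V * X).trace := by
  rw [kraus_apply, Matrix.trace_mul_comm, ← Matrix.mul_assoc]

theorem isTP_sum_kraus {A A' K : Type} [Fintype A] [DecidableEq A] [Fintype A'] [DecidableEq A']
    [Fintype K] {V : K → Matrix A' A ℂ} (h : ∑ k, (V k).conjTranspose * V k = 1) :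
    IsTP (∑ k, kraus (V k)) := fun X => by
  rw [LinearMap.sum_apply, Matrix.trace_sum]
  simp_rw [trace_kraus]
  rw [← Matrix.trace_sum, ← Matrix.sum_mul, h, one_mul]

/-- Factor the defect as Cᴴ C and, for each row of C, add a Kraus operator that sends everything to
one fixed basis vector. -/
theorem exists_channel_completion {B B' K : Type} [Fintype B] [DecidableEq B] [Fintype B']
    [DecidableEq B'] [Nonempty B'] [Fintype K] (R : K → Matrix B' B ℂ)
    (h : (1 - ∑ k, (R k).conjTranspose * R k).PosSemidef) :
    ∃ D' : Op B →ₗ[ℂ] Op B', IsCP D' ∧ IsCP (∑ k, kraus (R k) + D') ∧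
      IsTP (∑ k, kraus (R k) + D') := by
  obtain ⟨C, hC⟩ := CStarAlgebra.nonneg_iff_eq_star_mul_self.mp h.nonneg
  let b0 : B' := Classical.arbitrary B'
  let T : B → Matrix B' B ℂ := fun j => Matrix.vecMulVec (Pi.single b0 1) (C j)
  have hT : ∑ j, (T j).conjTranspose * T j = C.conjTranspose * C := by
    ext i k
    simp [T, Matrix.sum_apply, Matrix.mul_apply, Matrix.vecMulVec_apply, Pi.single_apply]
  have hCP : IsCP (∑ j, kraus (T j)) := isCP_sum _ fun j => isCP_kraus (T j)
  have hsum : ∑ k, kraus (R k) + ∑ j, kraus (T j) = ∑ k : K ⊕ B, kraus (Sum.elim R T k) := by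
    rw [Fintype.sum_sum_type]; rfl
  refine ⟨∑ j, kraus (T j), hCP, ?_, ?_⟩
  · rw [hsum]
    exact isCP_sum _ fun j => isCP_kraus _
  · rw [hsum]
    refine isTP_sum_kraus ?_
    rw [Fintype.sum_sum_type]
    simp only [Sum.elim_inl, Sum.elim_inr]
    rw [hT, ← Matrix.star_eq_conjTranspose, ← hC]
    abel

/-- The standard maximally entangled vector of rank `M`. -/
def stdMaxEntangled (M : ℕ) (p : Fin M × Fin M) : ℂ :=
  ((1 / Real.sqrt M : ℝ) : ℂ) * if p.1 = p.2 then 1 else 0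

theorem isMaxEntangled_std {M : ℕ} (hM : 1 ≤ M) : IsMaxEntangled M M (stdMaxEntangled M) := by
  refine ⟨hM, le_rfl, EuclideanSpace.basisFun (Fin M) ℂ, EuclideanSpace.basisFun (Fin M) ℂ,
    fun p => ?_⟩
  simp [stdMaxEntangled, eq_comm]

theorem stdMaxEntangled_norm {M : ℕ} (hM : 1 ≤ M) :
    star (stdMaxEntangled M) ⬝ᵥ stdMaxEntangled M = 1 := by
  have hM' : (0 : ℝ) < M := by exact_mod_cast hM
  have h : (((1 / Real.sqrt M : ℝ) : ℂ)) * ((1 / Real.sqrt M : ℝ) : ℂ) * M = 1 := by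
    rw [← Complex.ofReal_mul, ← Complex.ofReal_natCast, ← Complex.ofReal_mul, ← Complex.ofReal_one]
    congr 1
    rw [div_mul_div_comm, Real.mul_self_sqrt hM'.le]
    field_simp
  rw [dotProduct, Fintype.sum_prod_type, ← h]
  simp only [Pi.star_apply, stdMaxEntangled, star_mul', Complex.star_def, Complex.conj_ofReal]
  simp
  ring

theorem projection_pureOp {ι : Type} [Fintype ι] {φ : ι → ℂ}
    (h : star φ ⬝ᵥ φ = 1) : (pureOp φ).conjTranspose = pureOp φ ∧
      pureOp φ * pureOp φ = pureOp φ := by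
  refine ⟨?_, ?_⟩
  · rw [pureOp, Matrix.conjTranspose_vecMulVec, star_star]
  · rw [pureOp, Matrix.vecMulVec_mul_vecMulVec, h, one_smul]

variable {a b M : ℕ} [NeZero M]

/-- Alice's Kraus operators. -/
def aliceKraus (g : HashPhase (Fin a) M) : Matrix (Fin M) (Fin a) ℂ :=
  (((Real.sqrt (Fintype.card (HashPhase (Fin a) M)))⁻¹ : ℝ) : ℂ) •
    Matrix.of fun i x => hashVec g x i

theorem card_hashPhase_pos (A : Type) [Fintype A] [DecidableEq A] (M : ℕ) [NeZero M] :
    (0 : ℝ) < Fintype.card (HashPhase A M) :=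
  Nat.cast_pos.mpr Fintype.card_pos

theorem inv_sqrt_mul_inv_sqrt {x : ℝ} (hx : 0 < x) :
    (((Real.sqrt x)⁻¹ : ℝ) : ℂ) * (((Real.sqrt x)⁻¹ : ℝ) : ℂ) = ((x⁻¹ : ℝ) : ℂ) := by
  rw [← Complex.ofReal_mul, ← mul_inv, Real.mul_self_sqrt hx.le]

theorem sum_aliceKraus :
    ∑ g : HashPhase (Fin a) M, (aliceKraus g).conjTranspose * aliceKraus g = 1 := by
  have hc := card_hashPhase_pos (Fin a) M
  have h (g : HashPhase (Fin a) M) : (aliceKraus g).conjTranspose * aliceKraus g =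
      (((Fintype.card (HashPhase (Fin a) M) : ℝ)⁻¹ : ℝ) : ℂ) •
        Matrix.of fun x y => hashGram g x y := by
    rw [aliceKraus, Matrix.conjTranspose_smul, Matrix.smul_mul, Matrix.mul_smul, smul_smul,
      Complex.star_def, Complex.conj_ofReal, inv_sqrt_mul_inv_sqrt hc]
    congr 1
    ext x y
    simp [Matrix.mul_apply, ← sum_hashVec]
  simp_rw [h]
  rw [← Finset.smul_sum]
  ext x y
  rw [Matrix.smul_apply, Matrix.sum_apply]
  simp only [Matrix.of_apply, sum_hashGram, Matrix.one_apply]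
  have hc' : ((Fintype.card (HashPhase (Fin a) M) : ℕ) : ℂ) ≠ 0 := by exact_mod_cast hc.ne'
  split_ifs
  · rw [smul_eq_mul]
    push_cast
    exact inv_mul_cancel₀ hc'
  · simp

/-- The slices of an operator on `A ⊗ B` along `A`. -/
def slice {A B : Type} (P : Op (A × B)) (x : A) : Matrix B (A × B) ℂ :=
  Matrix.of fun y f => P (x, y) f

theorem sum_slice_conj_mul {A B : Type} [Fintype A] [DecidableEq A] [Fintype B] [DecidableEq B]
    (P : Op (A × B)) :
    ∑ x, (slice P x).conjTranspose * slice P x = P.conjTranspose * P := by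
  ext f f'
  simp [Matrix.sum_apply, Matrix.mul_apply, slice, Fintype.sum_prod_type]

/-- Bob's Kraus operators. -/
def bobKraus (P : Op (Fin a × Fin b)) (g : HashPhase (Fin a) M) (f : Fin a × Fin b) :
    Matrix (Fin M) (Fin b) ℂ :=
  ((Real.sqrt M : ℝ) : ℂ) • Matrix.of fun i y => decoder (slice P) g i f y

/-- The row index f of the decoder becomes the Kraus index and i the output index; exchanging these
two sums reduces to `posSemidef_one_sub_decoder`. -/
theorem posSemidef_one_sub_bobKraus (P : Op (Fin a × Fin b)) (g : HashPhase (Fin a) M) :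
    (1 - ∑ f, (bobKraus P g f).conjTranspose * bobKraus P g f).PosSemidef := by
  convert posSemidef_one_sub_decoder (slice P) g using 2
  have h (f : Fin a × Fin b) : (bobKraus P g f).conjTranspose * bobKraus P g f = (M : ℂ) •
      ((Matrix.of fun i y => decoder (slice P) g i f y).conjTranspose *
        Matrix.of fun i y => decoder (slice P) g i f y) := by
    rw [bobKraus, Matrix.conjTranspose_smul, Matrix.smul_mul, Matrix.mul_smul, smul_smul,
      Complex.star_def, Complex.conj_ofReal, ← Complex.ofReal_mul,
      Real.mul_self_sqrt (Nat.cast_nonneg M)]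
    simp
  simp_rw [h]
  rw [← Finset.smul_sum]
  congr 1
  ext y y'
  simp only [Matrix.sum_apply, Matrix.mul_apply, Matrix.conjTranspose_apply, Matrix.of_apply]
  exact Finset.sum_comm

/-- The operators whose average approximates the projector `P`. -/
def overlapOp (P : Op (Fin a × Fin b)) (g : HashPhase (Fin a) M) : Op (Fin a × Fin b) :=
  Matrix.of fun f p => ∑ i, hashVec g p.1 i * (decoder (slice P) g i) f p.2

theorem overlapOp_mul (P : Op (Fin a × Fin b)) (g : HashPhase (Fin a) M) :
    overlapOp P g * P = ∑ i, decoder (slice P) g i * hashed (slice P) g i := by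
  ext f f'
  simp only [overlapOp, Matrix.mul_apply, Matrix.of_apply, Matrix.sum_apply, hashed,
    Matrix.smul_apply, smul_eq_mul, Finset.sum_mul, Finset.mul_sum, slice, Fintype.sum_prod_type]
  rw [Finset.sum_comm]
  conv_rhs => rw [Finset.sum_comm]
  refine Finset.sum_congr rfl fun y _ => ?_
  rw [Finset.sum_comm]
  refine Finset.sum_congr rfl fun i _ => Finset.sum_congr rfl fun x _ => ?_
  ring

/-- Pull the maximally entangled vector back through the adjoint Kraus operators: Bob's √M cancels
its 1/√M and leaves a multiple of the conjugated row f of `overlapOp`. -/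
theorem trace_kraus_mul_stdMaxEntangled (P : Op (Fin a × Fin b)) (g : HashPhase (Fin a) M)
    (f : Fin a × Fin b) (X : Op (Fin a × Fin b)) :
    (tensorMap (kraus (aliceKraus g)) (kraus (bobKraus P g f)) X *
        pureOp (stdMaxEntangled M)).trace =
      (((Fintype.card (HashPhase (Fin a) M) : ℝ)⁻¹ : ℝ) : ℂ) *
        (overlapOp P g * X * (overlapOp P g).conjTranspose) f f := by
  have hc := card_hashPhase_pos (Fin a) M
  have hM : Real.sqrt M ≠ 0 := (Real.sqrt_pos.mpr (Nat.cast_pos.mpr (NeZero.pos M))).ne'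
  set c : ℂ := (((Real.sqrt (Fintype.card (HashPhase (Fin a) M)))⁻¹ : ℝ) : ℂ) with hcdef
  set K := aliceKraus g ⊗ₖ bobKraus P g f with hK
  have hw : K.conjTranspose.mulVec (stdMaxEntangled M) = c • star (overlapOp P g f) := by
    ext p
    have hs : (((Real.sqrt M : ℝ) : ℂ)) * ((1 / Real.sqrt M : ℝ) : ℂ) = 1 := by
      rw [← Complex.ofReal_mul, mul_one_div_cancel hM, Complex.ofReal_one]
    simp only [Matrix.mulVec, dotProduct, Fintype.sum_prod_type, hK, Matrix.conjTranspose_apply,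
      Matrix.kroneckerMap_apply, stdMaxEntangled, aliceKraus, bobKraus, Matrix.smul_apply,
      Matrix.of_apply, overlapOp, Pi.smul_apply, Pi.star_apply, star_sum, star_mul', smul_eq_mul,
      Complex.star_def, Complex.conj_ofReal, mul_ite, mul_one, mul_zero, Finset.sum_ite_eq,
      Finset.mem_univ, if_true, Finset.mul_sum]
    refine Finset.sum_congr rfl fun i _ => ?_
    rw [← hcdef]
    linear_combination (c * (starRingEnd ℂ) (hashVec g p.1 i) *
      (starRingEnd ℂ) ((decoder (slice P) g i) f p.2)) * hs
  rw [tensorMap_kraus, ← hK, kraus_apply, ← dotProduct_mulVec_eq_trace, ← Matrix.mulVec_mulVec,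
    ← Matrix.mulVec_mulVec, Matrix.dotProduct_mulVec, ← Matrix.conjTranspose_conjTranspose K,
    ← Matrix.star_mulVec, Matrix.conjTranspose_conjTranspose, hw, star_smul, star_star,
    Matrix.mulVec_smul, smul_dotProduct, dotProduct_smul, smul_smul, hcdef, Complex.star_def,
    Complex.conj_ofReal, inv_sqrt_mul_inv_sqrt hc, smul_eq_mul]
  congr 1
  rw [mul_assoc]
  simp only [Matrix.mul_apply, dotProduct, Matrix.mulVec, Matrix.conjTranspose_apply,
    Pi.star_apply]

/-- The protocol in which Alice hashes and Bob decodes: on every positive operator the overlap with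
the maximally entangled vector is at least the average over the outcomes. -/
theorem exists_hashing_protocol (P : Op (Fin a × Fin b)) :
    ∃ L : BipartiteMap a b M M, IsOneWayLOCC L ∧ ∀ X : Op (Fin a × Fin b), X.PosSemidef →
      (Fintype.card (HashPhase (Fin a) M) : ℝ)⁻¹ * ∑ g : HashPhase (Fin a) M,
          (overlapOp P g * X * (overlapOp P g).conjTranspose).trace.re ≤
        (L X * pureOp (stdMaxEntangled M)).trace.re := by
  choose D' hD' hCP hTP using fun g : HashPhase (Fin a) M =>
    exists_channel_completion (bobKraus P g) (posSemidef_one_sub_bobKraus P g)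
  refine ⟨_, isOneWayLOCC_sum (E := fun g : HashPhase (Fin a) M => kraus (aliceKraus g))
    (fun g => isCP_kraus _) (isTP_sum_kraus sum_aliceKraus) fun g => ⟨hCP g, hTP g⟩, ?_⟩
  intro X hX
  have hφ : (pureOp (stdMaxEntangled M)).PosSemidef :=
    Matrix.posSemidef_vecMulVec_self_star _
  rw [LinearMap.sum_apply, Matrix.sum_mul, Matrix.trace_sum, Complex.re_sum, Finset.mul_sum]
  refine Finset.sum_le_sum fun g _ => ?_
  have hadd : tensorMap (kraus (aliceKraus g)) (∑ f, kraus (bobKraus P g f) + D' g) =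
      (∑ f, tensorMap (kraus (aliceKraus g)) (kraus (bobKraus P g f))) +
        tensorMap (kraus (aliceKraus g)) (D' g) := by
    rw [← tensorMap_sum_right]
    exact ext_kronecker fun Y Z => by simp [tensorMap_kronecker, Matrix.kronecker_add]
  rw [hadd, LinearMap.add_apply, add_mul, Matrix.trace_add, Complex.add_re]
  -- The part of Bob's channel added for trace preservation can only increase the overlap, so it is
  -- dropped.
  have h0 := trace_mul_re_nonneg ((isCP_kraus (aliceKraus g)).tensorMap (hD' g) X hX) hφ
  refine le_trans (le_of_eq ?_) (le_add_of_nonneg_right h0)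
  rw [LinearMap.sum_apply, Matrix.sum_mul, Matrix.trace_sum]
  simp_rw [trace_kraus_mul_stdMaxEntangled]
  rw [← Finset.mul_sum, Complex.re_ofReal_mul]
  rfl

theorem exists_protocol {ρ P : Op (Fin a × Fin b)} (hρ : IsState ρ) (hP1 : P.conjTranspose = P)
    (hP2 : P * P = P) {κ δ : ℝ}
    (hκ : ((κ : ℂ) • (1 : Op (Fin b)) - ∑ x, slice P x * (slice P x).conjTranspose).PosSemidef)
    (hδ : 0 < δ) (ht : 1 - δ ^ 2 ≤ (P * ρ).trace.re) (hMκ : M * κ ≤ 2) :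
    ∃ L : BipartiteMap a b M M, IsOneWayLOCC L ∧
      ((1 - M * κ / 2) * (P * ρ).trace.re) ^ 2 ≤
        (1 + δ) * ((L ρ * pureOp (stdMaxEntangled M)).trace.re + δ) := by
  have hM : 1 ≤ M := NeZero.pos M
  have hc := card_hashPhase_pos (Fin a) M
  obtain ⟨L, hL, hLX⟩ := exists_hashing_protocol (M := M) P
  refine ⟨L, hL, ?_⟩
  set c : ℝ := ((Fintype.card (HashPhase (Fin a) M) : ℕ) : ℝ) with hcdef
  set Φ := pureOp (stdMaxEntangled M) with hΦdef
  have hΦ : Φ.PosSemidef := Matrix.posSemidef_vecMulVec_self_star _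
  have hPpsd := posSemidef_of_projection hP1 hP2
  set t := (P * ρ).trace.re with htdef
  have ht0 : 0 ≤ t := trace_mul_re_nonneg hPpsd hρ.1
  set s := (1 - M * κ / 2) * t with hs
  have hs0 : 0 ≤ s := mul_nonneg (by linarith) ht0
  have hNN : ∑ x, (slice P x).conjTranspose * slice P x = P := by
    rw [sum_slice_conj_mul, hP1, hP2]
  -- the overlap of the projected state
  have h1 : s ^ 2 ≤ (L (P * ρ * P) * Φ).trace.re := by
    have hle := le_trace_decoder (M := M) (slice P) (by rw [hNN, hP2]) hκ hρ.1
    rw [hNN] at hle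
    simp_rw [← overlapOp_mul] at hle
    rw [Finset.sum_mul, Matrix.trace_sum, Complex.re_sum] at hle
    have hq : c * s ≤ ∑ g : HashPhase (Fin a) M, (overlapOp P g * P * ρ).trace.re := by
      rw [hs, ← mul_assoc]; exact hle
    -- Positivity of (R - s) ρ (R - s)ᴴ for R = `overlapOp P g * P` bounds the quadratic overlap
    -- below by an affine one; averaging over g then uses only the mean, which is at least s.
    have hpt (g : HashPhase (Fin a) M) : 2 * s * (overlapOp P g * P * ρ).trace.re - s ^ 2 ≤
        (overlapOp P g * (P * ρ * P) * (overlapOp P g).conjTranspose).trace.re := by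
      have h := PosSemidef.trace_re_nonneg
        (hρ.1.mul_mul_conjTranspose_same (overlapOp P g * P - (s : ℂ) • 1))
      have h2 : (ρ * (overlapOp P g * P).conjTranspose).trace.re =
          (overlapOp P g * P * ρ).trace.re := by
        rw [← Complex.conj_re, starRingEnd_apply, ← Matrix.trace_conjTranspose]
        simp [hρ.1.1.eq]
      have h3 : overlapOp P g * P * ρ * (overlapOp P g * P).conjTranspose =
          overlapOp P g * (P * ρ * P) * (overlapOp P g).conjTranspose := by
        rw [Matrix.conjTranspose_mul, hP1]; simp only [mul_assoc]
      simp only [Matrix.conjTranspose_sub, Matrix.conjTranspose_smul, Matrix.conjTranspose_one,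
        sub_mul, mul_sub, Matrix.trace_sub, Complex.sub_re, Matrix.smul_mul, Matrix.mul_smul,
        one_mul, mul_one, Matrix.trace_smul, Complex.star_def, Complex.conj_ofReal, smul_eq_mul,
        Complex.re_ofReal_mul, h2, h3, hρ.2, Complex.ofReal_re] at h
      linarith
    have h4 := hLX (P * ρ * P) (by
      have := hρ.1.mul_mul_conjTranspose_same P
      rwa [hP1] at this)
    refine le_trans ?_ h4
    rw [inv_mul_eq_div, le_div_iff₀ hc]
    refine le_trans ?_ (Finset.sum_le_sum fun g _ => hpt g)
    rw [Finset.sum_sub_distrib, ← Finset.mul_sum, Finset.sum_const, Finset.card_univ, nsmul_eq_mul,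
      ← hcdef]
    nlinarith
  -- the overlap of the complementary part
  set Q := 1 - P with hQ
  have hQ1 : Q.conjTranspose = Q := by rw [hQ]; simp [hP1]
  have hQ2 : Q * Q = Q := by rw [hQ]; simp [mul_sub, sub_mul, hP2]
  have hQρ : (Q * ρ * Q).PosSemidef := by
    have := hρ.1.mul_mul_conjTranspose_same Q
    rwa [hQ1] at this
  have h2 : (L (Q * ρ * Q) * Φ).trace.re ≤ δ ^ 2 := by
    have h3 := (projection_pureOp (stdMaxEntangled_norm hM))
    have h4 := trace_mul_re_nonneg (hL.isPositiveMap_isTP.1 _ hQρ)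
      (posSemidef_one_sub_of_projection h3.1 h3.2)
    rw [mul_sub, mul_one, Matrix.trace_sub, Complex.sub_re, sub_nonneg,
      hL.isPositiveMap_isTP.2] at h4
    refine h4.trans ?_
    rw [Matrix.trace_mul_comm, ← mul_assoc, hQ2, hQ, sub_mul, one_mul, Matrix.trace_sub, hρ.2,
      Complex.sub_re, Complex.one_re]
    linarith
  -- pinching
  have h3 : (L (P * ρ * P) * Φ).trace.re ≤
      (1 + δ) * (L ρ * Φ).trace.re + (1 + δ⁻¹) * (L (Q * ρ * Q) * Φ).trace.re := by
    -- Z = √δ + Q/√δ is chosen so that the cross terms of Z ρ Zᴴ cancel those of P ρ P = (1 - Q) ρ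
    -- (1 - Q).
    set Z : Op (Fin a × Fin b) := ((Real.sqrt δ : ℝ) : ℂ) • 1 + (((Real.sqrt δ)⁻¹ : ℝ) : ℂ) • Q
      with hZ
    have hZρ := hρ.1.mul_mul_conjTranspose_same Z
    have hsq : ((Real.sqrt δ : ℝ) : ℂ) * ((Real.sqrt δ : ℝ) : ℂ) = (δ : ℂ) := by
      rw [← Complex.ofReal_mul, Real.mul_self_sqrt hδ.le]
    have hsi : ((Real.sqrt δ : ℝ) : ℂ) * (((Real.sqrt δ)⁻¹ : ℝ) : ℂ) = 1 := by
      rw [← Complex.ofReal_mul, mul_inv_cancel₀ (Real.sqrt_pos.mpr hδ).ne', Complex.ofReal_one]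
    have heq : Z * ρ * Z.conjTranspose =
        ((1 + δ : ℝ) : ℂ) • ρ + ((1 + δ⁻¹ : ℝ) : ℂ) • (Q * ρ * Q) - P * ρ * P := by
      have hPQ : P = 1 - Q := by rw [hQ]; abel
      rw [hZ, hPQ]
      simp only [Matrix.conjTranspose_add, Matrix.conjTranspose_smul, Matrix.conjTranspose_one, hQ1,
        Complex.star_def, Complex.conj_ofReal, add_mul, mul_add, sub_mul, mul_sub, Matrix.smul_mul,
        Matrix.mul_smul, one_mul, mul_one, smul_smul, hsq, hsi, inv_sqrt_mul_inv_sqrt hδ]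
      rw [mul_comm _ ((Real.sqrt δ : ℝ) : ℂ), hsi]
      push_cast
      module
    have h5 := trace_mul_re_nonneg (hL.isPositiveMap_isTP.1 _ hZρ) hΦ
    rw [heq] at h5
    simp only [map_sub, map_add, map_smul, add_mul, sub_mul, Matrix.smul_mul, Matrix.trace_add,
      Matrix.trace_sub, Matrix.trace_smul, Complex.add_re, Complex.sub_re, smul_eq_mul,
      Complex.re_ofReal_mul] at h5
    linarith
  -- Using the leakage amplitude δ also as the pinching parameter gives the error (1 + δ⁻¹)δ² = (1 +
  -- δ)δ.
  have h6 : (1 + δ⁻¹) * (L (Q * ρ * Q) * Φ).trace.re ≤ (1 + δ) * δ := by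
    refine (mul_le_mul_of_nonneg_left h2 (by positivity)).trans (le_of_eq ?_)
    field_simp
    ring
  linarith

end Protocol

/-! ### From the hashing quantity to the protocol -/

section Hashing

variable {A B : Type} [Fintype A] [DecidableEq A] [Fintype B] [DecidableEq B]

/-- This identifies ∑ N_x N_xᴴ with the partial trace of P over A, the operator tested by states on
B in the zero-coherent information. -/
theorem sum_slice_mul_conj_apply {P : Op (A × B)} (hP1 : P.conjTranspose = P) (hP2 : P * P = P)
    (y y' : B) :
    (∑ x, slice P x * (slice P x).conjTranspose) y y' = ∑ x, P (x, y) (x, y') := by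
  rw [Matrix.sum_apply]
  refine Finset.sum_congr rfl fun x _ => ?_
  have h : P (x, y) (x, y') = (P * P.conjTranspose) (x, y) (x, y') := by rw [hP1, hP2]
  rw [h]
  rfl

theorem trace_mul_one_kronecker {P : Op (A × B)} (hP1 : P.conjTranspose = P) (hP2 : P * P = P)
    (τ : Op B) :
    (P * ((1 : Op A) ⊗ₖ τ)).trace =
      ((∑ x, slice P x * (slice P x).conjTranspose) * τ).trace := by
  have hr (y : B) : ((∑ x, slice P x * (slice P x).conjTranspose) * τ) y y =
      ∑ x, ∑ y', P (x, y) (x, y') * τ y' y := by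
    rw [Matrix.mul_apply, Finset.sum_comm]
    simp only [sum_slice_mul_conj_apply hP1 hP2, Finset.sum_mul]
  rw [Matrix.trace, Matrix.trace, Fintype.sum_prod_type, Finset.sum_comm]
  refine Finset.sum_congr rfl fun y _ => ?_
  rw [Matrix.diag_apply, hr]
  simp [Matrix.mul_apply, Fintype.sum_prod_type, Matrix.one_apply]

theorem posSemidef_of_forall_state {T : Op B} (hT : T.IsHermitian) {κ : ℝ}
    (h : ∀ τ : Op B, IsState τ → (T * τ).trace.re ≤ κ) :
    ((κ : ℂ) • (1 : Op B) - T).PosSemidef := by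
  have hH : ((κ : ℂ) • (1 : Op B) - T).IsHermitian := by
    rw [Matrix.IsHermitian, Matrix.conjTranspose_sub, hT.eq, Matrix.conjTranspose_smul,
      Matrix.conjTranspose_one, Complex.star_def, Complex.conj_ofReal]
  refine Matrix.PosSemidef.of_dotProduct_mulVec_nonneg hH fun x => ?_
  have him : (star x ⬝ᵥ ((κ : ℂ) • (1 : Op B) - T).mulVec x).im = 0 := by
    have := hH.im_star_dotProduct_mulVec_self x
    simpa using this
  refine Complex.nonneg_iff.mpr ⟨?_, him.symm⟩
  by_cases hx : x = 0
  · simp [hx]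
  have hpos : 0 < star x ⬝ᵥ x := Matrix.dotProduct_star_self_pos_iff.mpr hx
  obtain ⟨hr, hi⟩ := Complex.pos_iff.mp hpos
  set r := (star x ⬝ᵥ x).re with hrdef
  have hxx : star x ⬝ᵥ x = (r : ℂ) := Complex.ext rfl hi.symm
  have hst : IsState (((r⁻¹ : ℝ) : ℂ) • pureOp x) := by
    refine ⟨(Matrix.posSemidef_vecMulVec_self_star x).smul ?_, ?_⟩
    · exact_mod_cast inv_nonneg.mpr hr.le
    · rw [Matrix.trace_smul, pureOp, Matrix.trace_vecMulVec, dotProduct_comm, hxx, smul_eq_mul,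
        ← Complex.ofReal_mul, inv_mul_cancel₀ hr.ne', Complex.ofReal_one]
  have h1 := h _ hst
  rw [Matrix.mul_smul, Matrix.trace_smul, smul_eq_mul, Complex.re_ofReal_mul,
    ← dotProduct_mulVec_eq_trace, inv_mul_le_iff₀ hr] at h1
  rw [Matrix.sub_mulVec, dotProduct_sub, Complex.sub_re, Matrix.smul_mulVec, Matrix.one_mulVec,
    dotProduct_smul, smul_eq_mul, Complex.re_ofReal_mul, ← hrdef]
  linarith

/-- With X_x = N_xᴴ N_x one has Tr P = Tr P² = ∑ Tr[X_x X_y] ≤ d ∑ Tr[X_x²] ≤ dκ Tr P, where d is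
the dimension of A. The resulting 1/d ≤ κ is what disposes of the term 1/d in the hashing quantity.
-/
theorem one_le_card_mul {P : Op (A × B)} (hP1 : P.conjTranspose = P) (hP2 : P * P = P)
    (hP0 : P ≠ 0) {κ : ℝ}
    (hκ : ((κ : ℂ) • (1 : Op B) - ∑ x, slice P x * (slice P x).conjTranspose).PosSemidef) :
    1 ≤ Fintype.card A * κ := by
  set X : A → Op (A × B) := fun x => (slice P x).conjTranspose * slice P x with hX
  have hXP : ∑ x, X x = P := by rw [hX, sum_slice_conj_mul, hP1, hP2]
  have hXh (x : A) : (X x).conjTranspose = X x := by simp [hX]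
  have hPpsd := posSemidef_of_projection hP1 hP2
  have hr : 0 < P.trace.re := by
    have h0 := hPpsd.trace_nonneg
    refine lt_of_le_of_ne (PosSemidef.trace_re_nonneg hPpsd) fun h => hP0 ?_
    exact hPpsd.trace_eq_zero_iff.mp (Complex.ext h.symm (Complex.nonneg_iff.mp h0).2.symm)
  have h1 (x y : A) : (X x * X y).trace.re ≤
      ((X x * X x).trace.re + (X y * X y).trace.re) / 2 := by
    have h := PosSemidef.trace_re_nonneg (Matrix.posSemidef_conjTranspose_mul_self (X x - X y))
    rw [Matrix.conjTranspose_sub, hXh, hXh] at h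
    simp only [sub_mul, mul_sub, Matrix.trace_sub, Complex.sub_re] at h
    rw [Matrix.trace_mul_comm (X y) (X x)] at h
    linarith
  have h2 (x : A) : (X x * X x).trace.re ≤ κ * (X x).trace.re := by
    have hle : ((κ : ℂ) • (1 : Op B) - slice P x * (slice P x).conjTranspose).PosSemidef := by
      have h3 : (∑ z ∈ Finset.univ.erase x, slice P z * (slice P z).conjTranspose).PosSemidef :=
        Matrix.posSemidef_sum _ fun z _ => Matrix.posSemidef_self_mul_conjTranspose _
      have h4 := hκ.add h3
      rwa [← Finset.add_sum_erase _ _ (Finset.mem_univ x), sub_add_eq_sub_sub,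
        sub_add_cancel] at h4
    have h := PosSemidef.trace_re_nonneg (hle.conjTranspose_mul_mul_same (slice P x))
    rw [Matrix.mul_sub, Matrix.sub_mul, Matrix.trace_sub, Complex.sub_re, Matrix.mul_smul,
      Matrix.mul_one, Matrix.smul_mul, Matrix.trace_smul, smul_eq_mul, Complex.re_ofReal_mul,
      sub_nonneg] at h
    refine le_trans (le_of_eq ?_) h
    simp only [hX, Matrix.mul_assoc]
  have h3 : P.trace.re = ∑ x, ∑ y, (X x * X y).trace.re := by
    conv_lhs => rw [← hP2, ← hXP]
    rw [Finset.sum_mul_sum]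
    simp only [Matrix.trace_sum, Complex.re_sum]
  have h4 : ∑ x, (X x).trace.re = P.trace.re := by
    rw [← hXP, Matrix.trace_sum, Complex.re_sum]
  have h5 : P.trace.re ≤ Fintype.card A * ∑ x, (X x * X x).trace.re := by
    rw [h3]
    refine (Finset.sum_le_sum fun x _ => Finset.sum_le_sum fun y _ => h1 x y).trans (le_of_eq ?_)
    simp only [← Finset.sum_div, Finset.sum_add_distrib, Finset.sum_const, Finset.card_univ,
      nsmul_eq_mul, ← Finset.mul_sum]
    ring
  have h6 : ∑ x, (X x * X x).trace.re ≤ κ * P.trace.re := by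
    rw [← h4, Finset.mul_sum]
    exact Finset.sum_le_sum fun x _ => h2 x
  have h7 : 1 * P.trace.re ≤ Fintype.card A * κ * P.trace.re := by
    rw [one_mul, mul_assoc]
    exact h5.trans (mul_le_mul_of_nonneg_left h6 (Nat.cast_nonneg _))
  exact le_of_mul_le_mul_right h7 hr

theorem le_rpow_of_lt_negLog {x r : ℝ} (h : (r : EReal) < negLog x) : x ≤ 2 ^ (-r) := by
  rw [negLog] at h
  split_ifs at h with hx
  · exact hx.trans (by positivity)
  · push Not at hx
    rw [EReal.coe_lt_coe_iff] at h
    rw [← Real.logb_le_iff_le_rpow (by norm_num) hx]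
    linarith

/-- Unfolding of a lower bound on the hashing quantity. -/
theorem exists_projector_of_lt_hashing {ρ : Op (A × B)} (hρ : IsState ρ) {ε c : ℝ}
    (h : (c : EReal) < hashing ε ρ) (hd : 0 < 1 / (Fintype.card A : ℝ) + ε ^ 2 / 4) :
    ∃ P : Op (A × B), P.conjTranspose = P ∧ P * P = P ∧ 1 - (ε / 8) ^ 2 ≤ (P * ρ).trace.re ∧
      ((((1 / (Fintype.card A : ℝ) + ε ^ 2 / 4) / 2 ^ c : ℝ) : ℂ) • (1 : Op B) -
        ∑ x, slice P x * (slice P x).conjTranspose).PosSemidef := by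
  set l := Real.logb 2 (1 / (Fintype.card A : ℝ) + ε ^ 2 / 4) with hl
  have h1 : ((c - l : ℝ) : EReal) < zeroCohInfo (ε / 8) ρ := by
    rw [EReal.coe_sub]
    exact EReal.sub_lt_of_lt_add h
  rw [zeroCohInfo, lt_iSup_iff] at h1
  obtain ⟨ρ', h1⟩ := h1
  rw [lt_iSup_iff] at h1
  obtain ⟨⟨hρ'1, hρ'2, hρ'3⟩, h1⟩ := h1
  have hP1 := supportProj_isHermitian ρ'
  have hP2 := supportProj_mul_self ρ'
  have hPpsd := posSemidef_of_projection hP1 hP2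
  refine ⟨supportProj ρ', hP1, hP2, ?_, ?_⟩
  · refine hρ'3.trans ((fidelity_sq_le hρ.1 hρ'1).trans ?_)
    exact mul_le_of_le_one_right (trace_mul_re_nonneg hPpsd hρ.1) hρ'2
  · refine posSemidef_of_forall_state ?_ fun τ hτ => ?_
    · exact (Matrix.posSemidef_sum _ fun x _ => Matrix.posSemidef_self_mul_conjTranspose _).1
    rw [← trace_mul_one_kronecker hP1 hP2]
    have h2 : ((c - l : ℝ) : EReal) < negLog (supportProj ρ' * ((1 : Op A) ⊗ₖ τ)).trace.re :=
      lt_of_lt_of_le h1 (iInf₂_le τ hτ)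
    refine (le_rpow_of_lt_negLog h2).trans (le_of_eq ?_)
    rw [neg_sub, Real.rpow_sub (by norm_num), hl, Real.rpow_logb (by norm_num) (by norm_num) hd]

/-- The factor 62/63 is slack that makes the hypothesis strict, so that the supremum over
preprocessing need not be attained; the numerical estimates below leave room for it. -/
theorem exists_isOneWayLOCC_of_lt_hashing {a b M : ℕ} {ρ : Op (Fin a × Fin b)} (hρ : IsState ρ)
    {ε : ℝ} (hε : 0 ≤ ε) (hε1 : ε < 1) (hM : 2 ≤ M)
    (h : ((Real.logb 2 (M * (62 / 63)) : ℝ) : EReal) < hashing ε ρ) :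
    ∃ L : BipartiteMap a b M M, IsOneWayLOCC L ∧
      1 - ε ≤ fidelity (L ρ) (pureOp (stdMaxEntangled M)) := by
  have hne : NeZero M := ⟨by omega⟩
  have hMR : (2 : ℝ) ≤ M := by exact_mod_cast hM
  have ha : 0 < a := by
    rcases Nat.eq_zero_or_pos a with rfl | h
    · have := hρ.2
      simp [Matrix.trace] at this
    · exact h
  have haR : (0 : ℝ) < a := by exact_mod_cast ha
  obtain ⟨P, hP1, hP2, ht, hκ⟩ := exists_projector_of_lt_hashing hρ h
    (by rw [Fintype.card_fin]; positivity)
  rw [Fintype.card_fin, Real.rpow_logb (by norm_num) (by norm_num) (by positivity)] at hκ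
  set κ : ℝ := (1 / (a : ℝ) + ε ^ 2 / 4) / (M * (62 / 63)) with hκdef
  have hP0 : P ≠ 0 := by
    rintro rfl
    rw [zero_mul, Matrix.trace_zero, Complex.zero_re] at ht
    nlinarith
  have hdκ := one_le_card_mul hP1 hP2 hP0 hκ
  rw [Fintype.card_fin] at hdκ
  have hinv : 1 / (a : ℝ) ≤ κ := by
    rw [div_le_iff₀ haR, mul_comm]; exact hdκ
  have hκpos : 0 < κ := lt_of_lt_of_le (by positivity) hinv
  have hMκ : M * κ = 63 / 62 * (1 / (a : ℝ) + ε ^ 2 / 4) := by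
    rw [hκdef]; field_simp
  -- From 1/a ≤ κ ≤ Mκ/2 follows Mκ ≤ (63/62)(Mκ/2 + ε²/4); solving for Mκ gives 63/122.
  have hbound : M * κ ≤ 63 / 122 * ε ^ 2 := by
    have : 2 * κ ≤ M * κ := mul_le_mul_of_nonneg_right hMR hκpos.le
    linarith
  have hMκ0 : 0 < M * κ := by positivity
  -- At ε = 0 the bound forces Mκ ≤ 0, so no rank M ≥ 2 satisfies the hypothesis.
  have hε0 : 0 < ε := by
    rcases hε.eq_or_lt with h0 | h0
    · rw [← h0] at hbound; norm_num at hbound; linarith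
    · exact h0
  obtain ⟨L, hL, hle⟩ := exists_protocol (M := M) hρ hP1 hP2 hκ (δ := ε / 8) (by positivity) ht
    (by nlinarith)
  refine ⟨L, hL, ?_⟩
  rw [fidelity_pureOp (hL.isPositiveMap_isTP.1 ρ hρ.1), dotProduct_mulVec_eq_trace]
  refine Real.le_sqrt_of_sq_le ?_
  set f := (L ρ * pureOp (stdMaxEntangled M)).trace.re
  -- Here 63/244 comes from Mκ/2 and 1/64 from (ε/8)²; their sum is below 7/25.
  have hs : 1 - 7 / 25 * ε ^ 2 ≤ (1 - M * κ / 2) * (P * ρ).trace.re := by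
    have h1 : 1 - 63 / 244 * ε ^ 2 ≤ 1 - M * κ / 2 := by linarith
    have h2 : 1 - ε ^ 2 / 64 ≤ (P * ρ).trace.re := by linarith
    have h3 : (1 - 63 / 244 * ε ^ 2) * (1 - ε ^ 2 / 64) ≤ (1 - M * κ / 2) * (P * ρ).trace.re :=
      mul_le_mul h1 h2 (by nlinarith) (by nlinarith)
    nlinarith [sq_nonneg (ε ^ 2)]
  have hs2 : (1 - 7 / 25 * ε ^ 2) ^ 2 ≤ (1 + ε / 8) * (f + ε / 8) :=
    (pow_le_pow_left₀ (by nlinarith) hs 2).trans hle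
  -- The fidelity is the square root of the overlap, so the target for f is (1 - ε)².
  have hfin : (1 + ε / 8) * ((1 - ε) ^ 2 + ε / 8) ≤ (1 - 7 / 25 * ε ^ 2) ^ 2 := by
    nlinarith [mul_pos hε0 hε0, mul_pos hε0 (sub_pos.mpr hε1),
      mul_pos (mul_pos hε0 hε0) (sub_pos.mpr hε1), sq_nonneg (ε ^ 2)]
  have := le_of_mul_le_mul_left (hfin.trans hs2) (by positivity)
  linarith

end Hashing

/-! ### Upper bound on the rank of distilled states, from the partial transpose -/

section UpperBound

/-- The spectrum of S lies in {-1, 0, 1}; explicitly, 1 - S = (1 - S²) + (S² - S)²/2. -/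
theorem posSemidef_one_sub_of_cube {ι : Type} [Fintype ι] [DecidableEq ι] {S : Op ι}
    (h1 : S.conjTranspose = S) (h2 : S * S * S = S) : (1 - S).PosSemidef := by
  have hQ1 : (S * S).conjTranspose = S * S := by rw [Matrix.conjTranspose_mul, h1]
  have hQ2 : (S * S) * (S * S) = S * S := by rw [← mul_assoc, h2]
  have h3 := Matrix.posSemidef_conjTranspose_mul_self (S * S - S)
  rw [Matrix.conjTranspose_sub, hQ1, h1] at h3
  have h4 := (posSemidef_one_sub_of_projection hQ1 hQ2).add
    (h3.smul (a := (1 / 2 : ℝ)) (by norm_num))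
  convert h4 using 1
  simp only [mul_sub, sub_mul, h2, ← mul_assoc]
  module

theorem trace_partialTranspose_mul {A B : Type} [Fintype A] [Fintype B] (X Y : Op (A × B)) :
    (partialTranspose X * partialTranspose Y).trace = (X * Y).trace := by
  simp only [Matrix.trace, Matrix.diag_apply, Matrix.mul_apply, partialTranspose_apply,
    Fintype.sum_prod_type]
  refine Finset.sum_congr rfl fun a _ => ?_
  rw [Finset.sum_comm' (t' := Finset.univ) (s' := fun _ => Finset.univ) (by simp)]
  conv_rhs => rw [Finset.sum_comm' (t' := Finset.univ) (s' := fun _ => Finset.univ) (by simp)]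
  refine Finset.sum_congr rfl fun c _ => ?_
  exact Finset.sum_comm

/-- The swap operator. -/
def swapOp (M : ℕ) : Op (Fin M × Fin M) := Matrix.of fun p q => if p = q.swap then 1 else 0

theorem swapOp_mul_self (M : ℕ) : swapOp M * swapOp M = 1 := by
  ext p q
  simp only [swapOp, Matrix.mul_apply, Matrix.of_apply, mul_ite, mul_one, mul_zero,
    Finset.sum_ite_eq', Finset.mem_univ, if_true, Matrix.one_apply]
  simp

/-- S is the swap on `Fin M × Fin M` carried over by the isometry with columns e_i ⊗ conj(f_j), and
the swap squares to 1. -/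
theorem partialTranspose_pureOp_cube {M d : ℕ} {ψ : Fin d × Fin d → ℂ}
    (hψ : IsMaxEntangled M d ψ) : ∃ S : Op (Fin d × Fin d), S.conjTranspose = S ∧
      S * S * S = S ∧ (M : ℂ) • partialTranspose (pureOp ψ) = S := by
  obtain ⟨hM1, hM, e, f, hψ⟩ := hψ
  have hMR : (0 : ℝ) < M := by exact_mod_cast hM1
  let U : Matrix (Fin d × Fin d) (Fin M × Fin M) ℂ :=
    Matrix.of fun p i => e (Fin.castLE hM i.1) p.1 * star (f (Fin.castLE hM i.2) p.2)
  have horth (b : OrthonormalBasis (Fin d) ℂ (EuclideanSpace ℂ (Fin d))) (i j : Fin M) :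
      ∑ p, star (b (Fin.castLE hM i) p) * b (Fin.castLE hM j) p = if i = j then 1 else 0 := by
    have := orthonormal_iff_ite.mp b.orthonormal (Fin.castLE hM i) (Fin.castLE hM j)
    rw [EuclideanSpace.inner_eq_star_dotProduct, dotProduct_comm] at this
    simp only [Fin.castLE_inj] at this
    rw [← this]
    rfl
  have hU : U.conjTranspose * U = 1 := by
    ext i j
    have h1 : (U.conjTranspose * U) i j =
        (∑ p, star (e (Fin.castLE hM i.1) p) * e (Fin.castLE hM j.1) p) *
          ∑ p, star (f (Fin.castLE hM j.2) p) * f (Fin.castLE hM i.2) p := by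
      rw [Finset.sum_mul_sum, Matrix.mul_apply, Fintype.sum_prod_type]
      refine Finset.sum_congr rfl fun p _ => Finset.sum_congr rfl fun q _ => ?_
      simp only [U, Matrix.conjTranspose_apply, Matrix.of_apply, star_mul', star_star]
      ring
    rw [h1, horth, horth, Matrix.one_apply]
    simp only [Prod.ext_iff, eq_comm (a := j.2)]
    by_cases h : i.1 = j.1 <;> by_cases h' : i.2 = j.2 <;> simp [h, h']
  have hSw : (swapOp M).conjTranspose = swapOp M := by
    ext p q
    simp only [swapOp, Matrix.conjTranspose_apply, Matrix.of_apply]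
    by_cases h : q = p.swap
    · simp [h]
    · have h' : ¬ p = q.swap := fun h' => h (by simp [h'])
      simp [h, h']
  refine ⟨U * swapOp M * U.conjTranspose, ?_, ?_, ?_⟩
  · simp only [Matrix.conjTranspose_mul, Matrix.conjTranspose_conjTranspose, hSw, Matrix.mul_assoc]
  · calc U * swapOp M * U.conjTranspose * (U * swapOp M * U.conjTranspose) *
          (U * swapOp M * U.conjTranspose)
        = U * (swapOp M * (U.conjTranspose * U) * swapOp M * (U.conjTranspose * U) * swapOp M) *
          U.conjTranspose := by simp only [Matrix.mul_assoc]
      _ = _ := by rw [hU, Matrix.mul_one, Matrix.mul_one, swapOp_mul_self, Matrix.one_mul]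
  · have hc : (M : ℂ) * (((1 / Real.sqrt M : ℝ) : ℂ) * ((1 / Real.sqrt M : ℝ) : ℂ)) = 1 := by
      rw [← Complex.ofReal_mul, ← Complex.ofReal_natCast, ← Complex.ofReal_mul,
        ← Complex.ofReal_one]
      congr 1
      rw [div_mul_div_comm, Real.mul_self_sqrt hMR.le]
      field_simp
    ext p q
    have h1 : (U * swapOp M * U.conjTranspose) p q =
        ∑ i : Fin M × Fin M, U p i.swap * star (U q i) := by
      rw [Matrix.mul_apply]
      refine Finset.sum_congr rfl fun i _ => ?_
      rw [Matrix.conjTranspose_apply, Matrix.mul_apply]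
      simp [swapOp]
    rw [h1, Matrix.smul_apply, partialTranspose_apply, pureOp, Matrix.vecMulVec_apply,
      Pi.star_apply, hψ, hψ, star_mul', Complex.star_def, Complex.conj_ofReal,
      Fintype.sum_prod_type, map_sum, smul_eq_mul]
    rw [show ∀ x y z w : ℂ, x * (y * z * (y * w)) = x * (y * y) * (z * w) by intros; ring, hc,
      one_mul, Finset.sum_mul_sum, Finset.sum_comm]
    refine Finset.sum_congr rfl fun i _ => Finset.sum_congr rfl fun j _ => ?_
    simp only [U, Matrix.of_apply, Prod.swap, map_mul, Complex.star_def,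
      Complex.conj_conj]
    ring

/-- All states obtained from `ρ` by LOCC have a bounded overlap with maximally entangled states. -/
theorem exists_rank_bound {a b : ℕ} {ρ : Op (Fin a × Fin b)} (hρ : ρ.IsHermitian) :
    ∃ K : ℝ, ∀ (M d : ℕ) (L : BipartiteMap a b d d) (ψ : Fin d × Fin d → ℂ), IsTwoWayLOCC L →
      IsMaxEntangled M d ψ → M * (L ρ * pureOp ψ).trace.re ≤ K := by
  set H := partialTranspose ρ with hH
  have hHh : H.conjTranspose = H := by
    ext p q
    exact hρ.apply (p.1, q.2) (q.1, p.2)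
  have hsq (c : ℝ) : ((H + (c : ℂ) • 1) * (H + (c : ℂ) • 1)).PosSemidef := by
    have h := Matrix.posSemidef_conjTranspose_mul_self (H + (c : ℂ) • 1)
    rwa [Matrix.conjTranspose_add, hHh, Matrix.conjTranspose_smul, Matrix.conjTranspose_one,
      Complex.star_def, Complex.conj_ofReal] at h
  -- H = ((H + 1)² - (H - 1)²)/4 is a difference of positive operators whose traces depend on ρ
  -- alone, so no spectral decomposition is needed.
  set P := (1 / 4 : ℝ) • ((H + ((1 : ℝ) : ℂ) • 1) * (H + ((1 : ℝ) : ℂ) • 1)) with hP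
  set N := (1 / 4 : ℝ) • ((H + ((-1 : ℝ) : ℂ) • 1) * (H + ((-1 : ℝ) : ℂ) • 1)) with hN
  have hPpsd : P.PosSemidef := (hsq 1).smul (by norm_num)
  have hNpsd : N.PosSemidef := (hsq (-1)).smul (by norm_num)
  have hPN : H = P - N := by
    rw [hP, hN]
    simp only [add_mul, mul_add, Matrix.smul_mul, Matrix.mul_smul, one_mul, mul_one,
      Complex.ofReal_neg, Complex.ofReal_one]
    module
  refine ⟨P.trace.re + N.trace.re, fun M d L ψ hL hψ => ?_⟩
  obtain ⟨S, hS1, hS3, hS⟩ := partialTranspose_pureOp_cube hψ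
  have hpos := hL.partialTranspose
  set L' := partialTranspose ∘ₗ L ∘ₗ partialTranspose with hL'
  have htr (X : Op (Fin a × Fin b)) : (L' X).trace = X.trace := by
    rw [hL', LinearMap.comp_apply, LinearMap.comp_apply, trace_partialTranspose,
      hL.isPositiveMap_isTP.2, trace_partialTranspose]
  have h1 : (M : ℂ) * (L ρ * pureOp ψ).trace = ((L' P - L' N) * S).trace := by
    have : L' P - L' N = partialTranspose (L ρ) := by
      rw [← map_sub, ← hPN]; rfl
    rw [this, ← hS, Matrix.mul_smul, Matrix.trace_smul, trace_partialTranspose_mul, smul_eq_mul]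
  have h2 : M * (L ρ * pureOp ψ).trace.re = ((L' P - L' N) * S).trace.re := by
    rw [← h1, ← Complex.ofReal_natCast, Complex.re_ofReal_mul]
  -- S ≤ 1 is tested against the image of P, and -S ≤ 1 against that of N.
  have h3 := trace_mul_re_nonneg (hpos P hPpsd) (posSemidef_one_sub_of_cube hS1 hS3)
  have h4 := trace_mul_re_nonneg (hpos N hNpsd)
    (posSemidef_one_sub_of_cube (S := -S) (by simp [hS1]) (by simp [hS3]))
  rw [mul_sub, mul_one, Matrix.trace_sub, Complex.sub_re, htr] at h3
  rw [mul_sub, mul_one, Matrix.trace_sub, Complex.sub_re, htr, mul_neg, Matrix.trace_neg,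
    Complex.neg_re] at h4
  rw [h2, sub_mul, Matrix.trace_sub, Complex.sub_re]
  linarith

end UpperBound

/-! ### The lower bounds on the distillable entanglement -/

section Main

theorem isTP_traceOut_kraus {a n : ℕ} [NeZero n] :
    IsTP (∑ j : Fin a, kraus (Matrix.single (0 : Fin n) j (1 : ℂ))) := by
  refine isTP_sum_kraus ?_
  simp only [Matrix.conjTranspose_single, star_one, Matrix.single_mul_single_same, mul_one]
  ext i j
  simp [Matrix.sum_apply, Matrix.single_apply, Matrix.one_apply, ite_and]

theorem exists_isOneWayLOCC (a b n : ℕ) [NeZero n] :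
    ∃ L : BipartiteMap a b n n, IsOneWayLOCC L := by
  refine ⟨_, isOneWayLOCC_sum (G := Unit)
    (E := fun _ => ∑ j : Fin a, kraus (Matrix.single (0 : Fin n) j (1 : ℂ)))
    (D := fun _ => ∑ j : Fin b, kraus (Matrix.single (0 : Fin n) j (1 : ℂ)))
    (fun _ => isCP_sum _ fun _ => isCP_kraus _) ?_
    fun _ => ⟨isCP_sum _ fun _ => isCP_kraus _, isTP_traceOut_kraus⟩⟩
  simpa using isTP_traceOut_kraus

/-- Relabelling of `A' ⊗ (B ⊗ X)` as a product of two systems. -/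
def registerEquiv (a b k : ℕ) : Fin a × Fin (b * k) ≃ Fin a × (Fin b × Fin k) :=
  Equiv.prodCongr (Equiv.refl (Fin a)) finProdFinEquiv.symm

/-- On receiving x, Bob applies the isometry |y⟩ ↦ |y, x⟩, so the classical register becomes part of
his system. -/
theorem exists_isOneWayLOCC_instrumentOutput {a b a' k : ℕ}
    {E : Fin k → (Op (Fin a) →ₗ[ℂ] Op (Fin a'))} (hE : IsInstrument E) :
    ∃ L : BipartiteMap a b a' (b * k), IsOneWayLOCC L ∧ ∀ X : Op (Fin a × Fin b),
      L X = (instrumentOutput E X).submatrix (registerEquiv a' b k) (registerEquiv a' b k) := by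
  let T : Fin k → Matrix (Fin (b * k)) (Fin b) ℂ := fun x => Matrix.of fun j y =>
    if finProdFinEquiv.symm j = (y, x) then 1 else 0
  have hT (x : Fin k) : (T x).conjTranspose * T x = 1 := by
    ext y y'
    rw [Matrix.mul_apply, ← Equiv.sum_comp finProdFinEquiv]
    simp only [T, Matrix.conjTranspose_apply, Matrix.of_apply, Equiv.symm_apply_apply,
      Fintype.sum_prod_type, Prod.mk.injEq, Matrix.one_apply]
    simp [ite_and, eq_comm]
  refine ⟨∑ x, tensorMap (E x) (kraus (T x)), ⟨k, E, fun x => kraus (T x), hE, fun x =>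
    ⟨isCP_kraus _, ?_⟩, rfl⟩, fun X => ?_⟩
  · have := isTP_sum_kraus (V := fun _ : Unit => T x) (by simp [hT])
    simpa using this
  · have h (x : Fin k) : tensorMap (E x) (kraus (T x)) =
        kraus ((1 : Op (Fin a')) ⊗ₖ T x) ∘ₗ tensorMap (E x) LinearMap.id := by
      rw [← tensorMap_kraus, kraus_one, tensorMap_comp]; rfl
    have hmul (x : Fin k) (Z : Op (Fin a' × Fin b)) (p q : Fin a' × Fin (b * k)) :
        kraus ((1 : Op (Fin a')) ⊗ₖ T x) Z p q =
          if x = (finProdFinEquiv.symm p.2).2 ∧ x = (finProdFinEquiv.symm q.2).2 then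
            Z (p.1, (finProdFinEquiv.symm p.2).1) (q.1, (finProdFinEquiv.symm q.2).1) else 0 := by
      have h1 (p : Fin a' × Fin (b * k)) (r : Fin a' × Fin b) :
          ((1 : Op (Fin a')) ⊗ₖ T x) p r = if x = (finProdFinEquiv.symm p.2).2 then
            (if r = (p.1, (finProdFinEquiv.symm p.2).1) then 1 else 0) else 0 := by
        simp only [Matrix.kroneckerMap_apply, Matrix.one_apply, T, Matrix.of_apply, Prod.ext_iff]
        rw [← ite_and, ite_mul, one_mul, zero_mul, ← ite_and]
        exact if_congr (by grind) rfl rfl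
      rw [kraus_apply, Matrix.mul_apply]
      simp only [Matrix.mul_apply, Matrix.conjTranspose_apply, h1]
      by_cases hp : x = (finProdFinEquiv.symm p.2).2
      · by_cases hq : x = (finProdFinEquiv.symm q.2).2
        · simp only [if_pos hp, if_pos hq, if_pos (And.intro hp hq), ite_mul, one_mul, zero_mul,
            Finset.sum_ite_eq', Finset.mem_univ, if_true, apply_ite star, star_one, star_zero,
            mul_ite, mul_one, mul_zero]
        · simp only [if_neg hq, if_neg fun h : _ ∧ _ => hq h.2, star_zero, mul_zero,
            Finset.sum_const_zero]
      · simp only [if_neg hp, if_neg fun h : _ ∧ _ => hp h.1, zero_mul, Finset.sum_const_zero]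
    ext p q
    rw [LinearMap.sum_apply, Matrix.sum_apply]
    simp only [h, LinearMap.comp_apply, hmul]
    simp only [instrumentOutput, Matrix.submatrix_apply, Matrix.of_apply, registerEquiv,
      Equiv.prodCongr_apply, Prod.map, Equiv.refl_apply]
    split_ifs with hpq
    · rw [Finset.sum_eq_single (finProdFinEquiv.symm p.2).2]
      · rw [if_pos ⟨rfl, hpq⟩]
      · intro x _ hx
        rw [if_neg fun h => hx h.1]
      · simp
    · exact Finset.sum_eq_zero fun x _ => if_neg fun h => hpq (h.1.symm.trans h.2)

theorem isState_instrumentOutput {a b a' k : ℕ}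
    {E : Fin k → (Op (Fin a) →ₗ[ℂ] Op (Fin a'))} (hE : IsInstrument E)
    {ρ : Op (Fin a × Fin b)} (hρ : IsState ρ) : IsState (instrumentOutput E ρ) := by
  obtain ⟨L, hL, h⟩ := exists_isOneWayLOCC_instrumentOutput (b := b) hE
  have h1 := isState_submatrix (registerEquiv a' b k).symm (hρ.map hL.isPositiveMap_isTP)
  rw [h, Matrix.submatrix_submatrix] at h1
  simpa using h1

theorem bestInstrumentHashing_le {a b : ℕ} {ρ : Op (Fin a × Fin b)} (hρ : IsState ρ) (ε : ℝ) :
    bestInstrumentHashing ρ ε ≤ bestHashing (oneWay a b) ρ ε := by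
  refine iSup_le fun a' => iSup_le fun k => iSup_le fun E => iSup_le fun hE => ?_
  obtain ⟨L, hL, h⟩ := exists_isOneWayLOCC_instrumentOutput (b := b) hE
  refine le_trans ?_ (le_iSup_of_le a' <| le_iSup_of_le (b * k) <| le_iSup_of_le L <|
    le_iSup_of_le hL le_rfl)
  rw [h]
  exact add_le_add_left (zeroCohInfo_le_submatrix finProdFinEquiv.symm
    (isState_instrumentOutput hE hρ).1 _) _

theorem negLog_nonneg {x : ℝ} (hx : x ≤ 1) : 0 ≤ negLog x := by
  rw [negLog]
  split_ifs with h
  · exact le_top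
  · rw [← EReal.coe_zero, EReal.coe_le_coe_iff]
    exact neg_nonneg.mpr (Real.logb_nonpos (by norm_num) (not_le.mp h).le hx)

/-- Take σ itself as the smoothed operator: for one-dimensional A, the trace of Π against 1 ⊗ τ is
at most 1, and the logarithmic term is log(1 + ε²/4) ≥ 0. -/
theorem hashing_nonneg_of_card_eq_one {A B : Type} [Fintype A] [DecidableEq A] [Fintype B]
    [DecidableEq B] (hA : Fintype.card A = 1) {σ : Op (A × B)} (hσ : IsState σ) (ε : ℝ) :
    0 ≤ hashing ε σ := by
  have h1 : (0 : EReal) ≤ zeroCohInfo (ε / 8) σ := by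
    have hmem : σ ∈ smoothBall σ (ε / 8) := by
      refine ⟨hσ.1, by rw [hσ.2]; simp, ?_⟩
      rw [fidelity_self hσ.1, hσ.2, Complex.one_re]
      nlinarith [sq_nonneg (ε / 8)]
    refine le_iSup₂_of_le σ hmem (le_iInf₂ fun τ hτ => negLog_nonneg ?_)
    have hle := trace_mul_re_nonneg (posSemidef_one_sub_of_projection
      (supportProj_isHermitian σ) (supportProj_mul_self σ))
      ((Matrix.PosSemidef.one (n := A)).kronecker hτ.1)
    rw [sub_mul, one_mul, Matrix.trace_sub, Complex.sub_re, Matrix.trace_kronecker, hτ.2,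
      Matrix.trace_one, hA] at hle
    simpa using hle
  refine add_nonneg h1 ?_
  rw [← EReal.coe_zero, EReal.coe_le_coe_iff, hA]
  exact Real.logb_nonneg (by norm_num) (by norm_num; positivity)

theorem bestInstrumentHashing_nonneg {a b : ℕ} {ρ : Op (Fin a × Fin b)} (hρ : IsState ρ) (ε : ℝ) :
    0 ≤ bestInstrumentHashing ρ ε := by
  have hE : IsInstrument fun _ : Fin 1 =>
      ∑ j : Fin a, kraus (Matrix.single (0 : Fin 1) j (1 : ℂ)) :=
    ⟨fun _ => isCP_sum _ fun _ => isCP_kraus _, by simpa using isTP_traceOut_kraus⟩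
  exact (hashing_nonneg_of_card_eq_one (by simp) (isState_instrumentOutput hE hρ) ε).trans
    (le_iSup_of_le 1 <| le_iSup_of_le 1 <| le_iSup_of_le _ <| le_iSup_of_le hE le_rfl)

theorem bestHashing_mono {a b : ℕ} {C C' : MapClass a b} (h : ∀ a' b' L, C a' b' L → C' a' b' L)
    (ρ : Op (Fin a × Fin b)) (ε : ℝ) : bestHashing C ρ ε ≤ bestHashing C' ρ ε :=
  iSup_le fun a' => iSup_le fun b' => iSup_le fun L => iSup_le fun hL =>
    le_iSup_of_le a' <| le_iSup_of_le b' <| le_iSup_of_le L <| le_iSup_of_le (h _ _ _ hL) le_rfl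

/-- The classes of LOCC maps that are closed under one-way postprocessing. -/
structure IsLOCCClass {a b : ℕ} (C : MapClass a b) : Prop where
  of_oneWay : ∀ {a' b'} {L : BipartiteMap a b a' b'}, IsOneWayLOCC L → C a' b' L
  comp : ∀ {a' b' a'' b''} {L : BipartiteMap a b a' b'} {L' : BipartiteMap a' b' a'' b''},
    C a' b' L → IsOneWayLOCC L' → C a'' b'' (L' ∘ₗ L)
  twoWay : ∀ {a' b'} {L : BipartiteMap a b a' b'}, C a' b' L → IsTwoWayLOCC L

theorem isLOCCClass_oneWay (a b : ℕ) : IsLOCCClass (oneWay a b) :=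
  ⟨fun h => h, fun h h' => h'.comp h, fun h => .forward h⟩

theorem isLOCCClass_twoWay (a b : ℕ) : IsLOCCClass (twoWay a b) :=
  ⟨fun h => .forward h, fun h h' => .comp h (.forward h'), fun h => h⟩

/-! ### Achievability of integer ranks and finiteness of the suprema. -/

variable {a b : ℕ} {C : MapClass a b} {ρ : Op (Fin a × Fin b)} {ε : ℝ}

theorem isAchievable_of_fidelity {M : ℕ} (hM : 1 ≤ M) {L : BipartiteMap a b M M} (hL : C M M L)
    (h : 1 - ε ≤ fidelity (L ρ) (pureOp (stdMaxEntangled M))) :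
    IsAchievable C ρ ε (Real.logb 2 M) := by
  have hM' : (1 : ℝ) ≤ M := by exact_mod_cast hM
  refine ⟨Real.logb_nonneg (by norm_num) hM', M, M, L, _, ?_, hL, isMaxEntangled_std hM, h⟩
  rw [Real.rpow_logb (by norm_num) (by norm_num) (by linarith)]

theorem le_distillable {R : ℝ} (h : IsAchievable C ρ ε R) : (R : EReal) ≤ distillable C ρ ε :=
  le_iSup₂_of_le R h le_rfl

/-- Since 1 - ε ≤ 0, every map meets the fidelity condition, and constant maps exist into every
nonzero dimension. -/
theorem distillable_eq_top (hC : IsLOCCClass C) (hε : 1 ≤ ε) : distillable C ρ ε = ⊤ := by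
  refine EReal.eq_top_iff_forall_lt _ |>.mpr fun y => ?_
  obtain ⟨n, hn⟩ := exists_nat_gt y
  have hne : NeZero (2 ^ n) := ⟨by positivity⟩
  obtain ⟨L, hL⟩ := exists_isOneWayLOCC a b (2 ^ n)
  have h := le_distillable (isAchievable_of_fidelity (ρ := ρ) (ε := ε) Nat.one_le_two_pow
    (hC.of_oneWay hL) ((sub_nonpos.mpr hε).trans (fidelity_nonneg _ _)))
  refine lt_of_lt_of_le ?_ h
  rw [EReal.coe_lt_coe_iff]
  push_cast
  rwa [Real.logb_pow, Real.logb_self_eq_one (by norm_num), mul_one]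

theorem isAchievable_of_le_bestHashing (hC : IsLOCCClass C) (hρ : IsState ρ) (hε : 0 ≤ ε)
    (hε1 : ε < 1) {M : ℕ} (hM : 1 ≤ M)
    (h : ((Real.logb 2 M : ℝ) : EReal) ≤ bestHashing C ρ ε) :
    IsAchievable C ρ ε (Real.logb 2 M) := by
  -- For M = 1 the target is the only state of a one-dimensional space; the hashing protocol needs M
  -- ≥ 2.
  obtain rfl | hM2 := hM.eq_or_lt
  · obtain ⟨L, hL⟩ := exists_isOneWayLOCC a b 1
    refine isAchievable_of_fidelity le_rfl (hC.of_oneWay hL) ?_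
    have hst := hρ.map hL.isPositiveMap_isTP
    have h1 : pureOp (stdMaxEntangled 1) = 1 := by
      ext p q
      have hp : p = q := Subsingleton.elim _ _
      subst hp
      have : p.1 = p.2 := Subsingleton.elim _ _
      simp [pureOp, Matrix.vecMulVec_apply, stdMaxEntangled, this]
    rw [fidelity_pureOp hst.1, dotProduct_mulVec_eq_trace, h1, mul_one, hst.2]
    simpa using hε
  · have hlt : ((Real.logb 2 (M * (62 / 63)) : ℝ) : EReal) < bestHashing C ρ ε := by
      refine lt_of_lt_of_le (EReal.coe_lt_coe_iff.mpr ?_) h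
      have : (0 : ℝ) < M := by exact_mod_cast hM
      exact Real.logb_lt_logb (by norm_num) (by positivity) (by linarith)
    simp only [bestHashing, lt_iSup_iff] at hlt
    obtain ⟨a', b', L, hL, hlt⟩ := hlt
    obtain ⟨L', hL', hF⟩ := exists_isOneWayLOCC_of_lt_hashing
      (hρ.map (hC.twoWay hL).isPositiveMap_isTP) hε hε1 hM2 hlt
    exact isAchievable_of_fidelity hM (hC.comp hL hL') hF

/-- If S were at least log(m + 1) with m > K/(1 - ε)², the corresponding rank would be distillable,
against `exists_rank_bound`. -/
theorem exists_bestHashing_lt (hC : IsLOCCClass C) (hρ : IsState ρ) (hε : 0 ≤ ε) (hε1 : ε < 1) :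
    ∃ M : ℕ, bestHashing C ρ ε < ((Real.logb 2 M : ℝ) : EReal) := by
  obtain ⟨K, hK⟩ := exists_rank_bound hρ.1.1
  obtain ⟨m, hm⟩ := exists_nat_gt (K / (1 - ε) ^ 2)
  have hpos : (0 : ℝ) < (1 - ε) ^ 2 := by
    have : 0 < 1 - ε := by linarith
    positivity
  refine ⟨m + 1, lt_of_not_ge fun h => ?_⟩
  obtain ⟨-, M, d, L, ψ, hM, hL, hψ, hF⟩ :=
    isAchievable_of_le_bestHashing hC hρ hε hε1 (Nat.le_add_left 1 m) h
  rw [Real.rpow_logb (by norm_num) (by norm_num) (by positivity)] at hM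
  have hst := hρ.map (hC.twoWay hL).isPositiveMap_isTP
  have h1 := hK M d L ψ (hC.twoWay hL) hψ
  rw [fidelity_pureOp hst.1, dotProduct_mulVec_eq_trace,
    Real.le_sqrt' (by linarith)] at hF
  have h2 : (M : ℝ) * (1 - ε) ^ 2 ≤ K :=
    (mul_le_mul_of_nonneg_left hF (Nat.cast_nonneg M)).trans h1
  rw [div_lt_iff₀ hpos] at hm
  push_cast at hM
  nlinarith

/-! ### Rounding down to logarithms of integers. -/

theorem exists_logb_floor {S : EReal} (h0 : 0 ≤ S)
    (h : ∃ M : ℕ, S < ((Real.logb 2 M : ℝ) : EReal)) :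
    ∃ n : ℕ, 1 ≤ n ∧ ((Real.logb 2 n : ℝ) : EReal) ≤ S ∧
      S < ((Real.logb 2 (n + 1) : ℝ) : EReal) := by
  classical
  set m := Nat.find h with hm
  have hspec : S < ((Real.logb 2 m : ℝ) : EReal) := Nat.find_spec h
  have hm2 : 2 ≤ m := by
    by_contra hlt
    -- `Real.logb 2 0` is 0 by convention, so m = 0 contradicts 0 ≤ S just as m = 1 does.
    have : m = 0 ∨ m = 1 := by omega
    obtain h1 | h1 := this <;> rw [h1] at hspec <;> simp at hspec <;>
      exact absurd h0 (not_le.mpr hspec)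
  obtain ⟨n, hn⟩ : ∃ n, m = n + 1 := ⟨m - 1, by omega⟩
  refine ⟨n, by omega, not_lt.mp (Nat.find_min h (by omega)), ?_⟩
  rw [hn] at hspec
  exact_mod_cast hspec

theorem toReal_sub_logb_mem_Icc {S : EReal} {n : ℕ} (hn : 1 ≤ n) (h1 : ((Real.logb 2 n : ℝ) : EReal) ≤ S)
    (h2 : S < ((Real.logb 2 (n + 1) : ℝ) : EReal)) :
    S.toReal - Real.logb 2 n ∈ Set.Icc (0 : ℝ) 1 ∧
      S - ((S.toReal - Real.logb 2 n : ℝ) : EReal) = ((Real.logb 2 n : ℝ) : EReal) := by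
  have hS : S = ((S.toReal : ℝ) : EReal) :=
    (EReal.coe_toReal (ne_top_of_lt h2) (ne_bot_of_le_ne_bot (EReal.coe_ne_bot _) h1)).symm
  rw [hS] at h1 h2
  rw [EReal.coe_le_coe_iff] at h1
  rw [EReal.coe_lt_coe_iff] at h2
  have hnR : (1 : ℝ) ≤ n := by exact_mod_cast hn
  have h3 : Real.logb 2 (n + 1) ≤ Real.logb 2 n + 1 := by
    have h4 : Real.logb 2 n + 1 = Real.logb 2 (n * 2) := by
      rw [Real.logb_mul (by linarith) (by norm_num), Real.logb_self_eq_one (by norm_num)]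
    rw [h4]
    exact Real.logb_le_logb_of_le (by norm_num) (by linarith) (by linarith)
  refine ⟨⟨by linarith, by linarith⟩, ?_⟩
  conv_lhs => lhs; rw [hS]
  rw [← EReal.coe_sub]
  congr 1
  ring

theorem logb_le_logb_of_floor {S S' : EReal} {n n' : ℕ} (hn' : 1 ≤ n') (hS : S' ≤ S)
    (h1 : ((Real.logb 2 n' : ℝ) : EReal) ≤ S') (h2 : S < ((Real.logb 2 (n + 1) : ℝ) : EReal)) :
    Real.logb 2 n' ≤ Real.logb 2 n := by
  have h3 := EReal.coe_lt_coe_iff.mp (lt_of_le_of_lt (h1.trans hS) h2)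
  have hnR : (1 : ℝ) ≤ n' := by exact_mod_cast hn'
  have h4 : (n' : ℝ) < n + 1 :=
    (Real.logb_lt_logb_iff (by norm_num) (by linarith) (by positivity)).mp h3
  have h5 : n' ≤ n := by
    have : n' < n + 1 := by exact_mod_cast h4
    omega
  exact Real.logb_le_logb_of_le (by norm_num) (by linarith) (by exact_mod_cast h5)

end Main

end QDistill

end

/-! ### Assembly of the lower bounds. -/

theorem mainTheorem3 (dA dB : ℕ) (ρ : QDistill.Op (Fin dA × Fin dB))
    (hρ : QDistill.IsState ρ) (ε : ℝ) (hε : 0 ≤ ε) :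
    (∃ Δ Δ' : ℝ, Δ ∈ Set.Icc (0 : ℝ) 1 ∧ Δ' ∈ Set.Icc (0 : ℝ) 1 ∧
      QDistill.bestHashing (QDistill.oneWay dA dB) ρ ε - (Δ : EReal)
        ≤ QDistill.distillable (QDistill.oneWay dA dB) ρ ε ∧
      QDistill.bestInstrumentHashing ρ ε - (Δ' : EReal)
        ≤ QDistill.bestHashing (QDistill.oneWay dA dB) ρ ε - (Δ : EReal) ∧
      (ε < 1 →
        QDistill.RoundsToLogNat (QDistill.bestHashing (QDistill.oneWay dA dB) ρ ε) Δ ∧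
        QDistill.RoundsToLogNat (QDistill.bestInstrumentHashing ρ ε) Δ')) ∧
    (∃ Δ'' : ℝ, Δ'' ∈ Set.Icc (0 : ℝ) 1 ∧
      QDistill.bestHashing (QDistill.twoWay dA dB) ρ ε - (Δ'' : EReal)
        ≤ QDistill.distillable (QDistill.twoWay dA dB) ρ ε ∧
      (ε < 1 →
        QDistill.RoundsToLogNat (QDistill.bestHashing (QDistill.twoWay dA dB) ρ ε) Δ'')) := by
  have h₁ := QDistill.isLOCCClass_oneWay dA dB
  have h₂ := QDistill.isLOCCClass_twoWay dA dB
  have hI := QDistill.bestInstrumentHashing_le hρ ε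
  obtain hε1 | hε1 := le_or_gt 1 ε
  -- For ε ≥ 1 no rounding is asked for, so all the Δ can be 0.
  · refine ⟨⟨0, 0, by simp, by simp, ?_, EReal.sub_le_sub hI le_rfl,
      fun h => absurd h (not_lt.mpr hε1)⟩, 0, by simp, ?_, fun h => absurd h (not_lt.mpr hε1)⟩
    · rw [QDistill.distillable_eq_top h₁ hε1]; exact le_top
    · rw [QDistill.distillable_eq_top h₂ hε1]; exact le_top
  have hI0 := QDistill.bestInstrumentHashing_nonneg hρ ε
  have hS0 := hI0.trans hI
  have hT0 := hS0.trans (QDistill.bestHashing_mono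
    (C' := QDistill.twoWay dA dB) (fun _ _ _ h => .forward h) ρ ε)
  have hSM := QDistill.exists_bestHashing_lt h₁ hρ hε hε1
  obtain ⟨n, hn, hn1, hn2⟩ := QDistill.exists_logb_floor hS0 hSM
  obtain ⟨n', hn', hn1', hn2'⟩ := QDistill.exists_logb_floor hI0
    (hSM.imp fun _ h => lt_of_le_of_lt hI h)
  obtain ⟨m, hm, hm1, hm2⟩ := QDistill.exists_logb_floor hT0
    (QDistill.exists_bestHashing_lt h₂ hρ hε hε1)
  obtain ⟨hΔ, hΔeq⟩ := QDistill.toReal_sub_logb_mem_Icc hn hn1 hn2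
  obtain ⟨hΔ', hΔeq'⟩ := QDistill.toReal_sub_logb_mem_Icc hn' hn1' hn2'
  obtain ⟨hΔ'', hΔeq''⟩ := QDistill.toReal_sub_logb_mem_Icc hm hm1 hm2
  refine ⟨⟨_, _, hΔ, hΔ', ?_, ?_, fun _ => ⟨⟨n, hn, hΔeq, hn2⟩, ⟨n', hn', hΔeq', hn2'⟩⟩⟩,
    _, hΔ'', ?_, fun _ => ⟨m, hm, hΔeq'', hm2⟩⟩
  · rw [hΔeq]
    exact QDistill.le_distillable (QDistill.isAchievable_of_le_bestHashing h₁ hρ hε hε1 hn hn1)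
  · rw [hΔeq, hΔeq', EReal.coe_le_coe_iff]
    exact QDistill.logb_le_logb_of_floor hn' hI hn1' hn2
  · rw [hΔeq'']
    exact QDistill.le_distillable (QDistill.isAchievable_of_le_bestHashing h₂ hρ hε hε1 hm hm1)
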